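/- **Setting.** Let $\mathcal C$ be a nonsingular projective curve over the finite field $\mathbb F_q$ ($q$ a power of the prime $p$), let $\infty$ be a closed point of $\mathcal C$, and let $A$ be the ring of functions on $\mathcal C$ that are regular everywhere except possibly at $\infty$. Let $K$ be a finitely generated field extension of $\mathbb F_q$, written as the function field of a fixed normal projective variety $V\subseteq\mathbb P^M$ over a finite extension of $\mathbb F_q$. Let $M_K$ be the set of discrete valuations of $K$ associated with the irreducible divisors of $V$; for $v_0\in M_K$ let $\deg(v_0)$ be the degree in $\mathbb P^M$ of the corresponding divisor. For a finite extension $L/K$ let $M_L$ be the set of valuations of $L$ associated with the irreducible divisors of the normalization of $V$ in $L$. All valuations are normalized to have value group $\mathbb Z$, so $v|_K=e(v|v_0)\,v_0$ when $v\in M_L$ lies above $v_0\in M_K$; $f(v|v_0)$ is the degree of the residue field extension. Let $K\{\tau\}$ be the ring of twisted polynomials, $\tau c=c^q\tau$, acting on $K^{\rm alg}$ by $\tau(x)=x^q$. Fix an injective morphism of $\mathbb F_q$-algebras $i:A\to K$, by which $A$ is identified with a subring of $K$. Let $\phi:A\to K\{\tau\}$, $a\mapsto\phi_a$, be a Drinfeld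 module of generic characteristic, i.e. a ring morphism such that the coefficient of $\tau^0$ in $\phi_a$ is $a$ for every $a\in A$. For $x\in L$ and $v\in M_L$ above $v_0\in M_K$, the local height of $x$ at $v$ is $$\hat h_v(x)=-\frac{\deg(v_0)\,f(v|v_0)}{[L:K]}\,\lim_{n\to\infty}\frac{\min\{0,v(\phi_{a^n}(x))\}}{\deg(\phi_{a^n})},$$ where $a\in A$ is any nonconstant element (the limit does not depend on it) and $\deg(\phi_{a^n})$ is $q$ to the power of the degree of $\phi_{a^n}$ in $\tau$. **Theorem.** There is a constant $C>0$, depending only on $\phi$ (and on the fixed model $V$ of $K$), with the following property. Let $t\in A$ be nonconstant with $$\phi_t=t\tau^0+\sum_{i=r_0}^{r}a_i\tau^i,\qquad r_0\ge 1,\ a_{r_0}\ne 0,\ a_r\neq 0 .$$ Let $x\in K^{\rm alg}$, let $v\in M_{K(x)}$ and let $v_0\in M_K$ be the place below $v$. If $v$ is not wildly ramified over $K$ (that is, $p\nmid e(v|v_0)$), if $v$ does not lie above the place $\infty$ of $\operatorname{Frac}(A)$, and if $\hat h_v(x)>0$, then $$\hat h_v(x)\ \ge\ \frac{C}{e(v|v_0)^{\frac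 r{r_0}-1}\,[K(x):K]} .$$ -/

import Mathlib

open scoped WithZero Polynomial

noncomputable section

/-! ### Normalised discrete valuations

A normalised discrete valuation (with value group `ℤ`) of a field `L` is a surjective
`w : Valuation L ℤᵐ⁰`; in additive notation it is `ordAt w`. -/

/-- The additive form of `w`, for nonzero `y` (the value at `0`, which should be `+∞`, is `0`). -/
def ordAt {L : Type*} [Field L] (w : Valuation L ℤᵐ⁰) (y : L) : ℤ :=
  -WithZero.log (w y)

/-- `min {0, w y}`, which is `0` for `y = 0` because then `w y = +∞`. -/
def ordMinus {L : Type*} [Field L] (w : Valuation L ℤᵐ⁰) (y : L) : ℤ :=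
  min 0 (ordAt w y)

/-- The ramification index `e(w|v)` of normalised valuations: the positive integer `e` such that
the restriction of `w` to `K` is `e` times `v`. -/
def ramificationIndex {K L : Type*} [Field K] [Field L] [Algebra K L]
    (v : Valuation K ℤᵐ⁰) (w : Valuation L ℤᵐ⁰) : ℕ :=
  sInf {e : ℕ | 0 < e ∧ ∀ y : K, ordAt w (algebraMap K L y) = e * ordAt v y}

/-- The residue degree `f(w|v)`. -/
def residueDegree {K L : Type*} [Field K] [Field L] [Algebra K L]
    (v : Valuation K ℤᵐ⁰) (w : Valuation L ℤᵐ⁰) [v.HasExtension w] : ℕ :=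
  Module.finrank (IsLocalRing.ResidueField v.valuationSubring)
    (IsLocalRing.ResidueField w.valuationSubring)

/-! ### The projective degree -/

/-- The Hilbert function of `k[X_0, …, X_M] / I`: the dimension of its part of degree `n`. -/
def hilbertFunction {k : Type*} [Field k] {M : ℕ} (I : Ideal (MvPolynomial (Fin (M + 1)) k))
    (n : ℕ) : ℕ :=
  Module.finrank k ((MvPolynomial.homogeneousSubmodule (Fin (M + 1)) k n).map
    (Ideal.Quotient.mkₐ k I).toLinearMap)

open Classical in
/-- The degree of the closed subvariety of `ℙ^M` with homogeneous ideal `I`, that is its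
intersection number with a general linear subspace of complementary dimension:
`D!` times the leading coefficient of the Hilbert polynomial, where `D` is the degree of the
Hilbert polynomial (the dimension of the subvariety). -/
def projectiveDegree {k : Type*} [Field k] {M : ℕ}
    (I : Ideal (MvPolynomial (Fin (M + 1)) k)) : ℚ :=
  if h : ∃ P : ℚ[X], ∃ n₀ : ℕ, ∀ n ≥ n₀, P.eval (n : ℚ) = hilbertFunction I n then
    (h.choose.natDegree.factorial : ℚ) * h.choose.leadingCoeff
  else 0

/-! ### Normal projective models -/

/-- A normal projective variety `V ⊆ ℙ^M` over `k` with function field `K`, given by its generic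
point `[ξ_0 : … : ξ_M] ∈ ℙ^M(K)`; `V` is the closure of this point, and its nonempty standard
affine charts are the spectra of the rings `k[ξ_0 / ξ_j, …, ξ_M / ξ_j] ⊆ K` with `ξ_j ≠ 0`. -/
structure NormalProjectiveModel (k K : Type*) [Field k] [Field K] [Algebra k K] where
  /-- the dimension of the ambient projective space -/
  M : ℕ
  /-- homogeneous coordinates of the generic point -/
  ξ : Fin (M + 1) → K
  ξ_ne_zero : ∃ j, ξ j ≠ 0
  /-- the function field of `V` is `K` -/
  functionField :
    IntermediateField.adjoin k (Set.range fun p : Fin (M + 1) × Fin (M + 1) => ξ p.1 / ξ p.2) = ⊤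
  /-- `V` is normal -/
  normal : ∀ j, ξ j ≠ 0 →
    IsIntegrallyClosed (Algebra.adjoin k (Set.range fun l => ξ l / ξ j) : Subalgebra k K)

namespace NormalProjectiveModel

variable {k K : Type*} [Field k] [Field K] [Algebra k K] (V : NormalProjectiveModel k K)

/-- The coordinate ring of the `j`-th standard affine chart of `V` (when `ξ_j ≠ 0`). -/
def chart (j : Fin (V.M + 1)) : Subalgebra k K :=
  Algebra.adjoin k (Set.range fun l => V.ξ l / V.ξ j)

/-- The set `M_L` of normalised valuations of `L` associated with the irreducible divisors of the
normalisation of `V` in `L`: those whose valuation ring is the local ring of the normalisation at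
a point of codimension one. For `L = K` the normalisation is `V` itself, and this is `M_K`. -/
def places (L : Type*) [Field L] [Algebra K L] : Set (Valuation L ℤᵐ⁰) :=
  {w | Function.Surjective w ∧ ∃ j : Fin (V.M + 1), V.ξ j ≠ 0 ∧
    ∃ 𝔓 : Ideal (integralClosure (V.chart j) L), 𝔓.IsPrime ∧ 𝔓.height = 1 ∧
      ∀ y : L, w y ≤ 1 ↔
        ∃ b s : integralClosure (V.chart j) L, s ∉ 𝔓 ∧ y = (b : L) / (s : L)}

/-- The homogeneous ideal of the irreducible divisor of `V` to which `v ∈ M_K` is associated. It is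
generated by the forms `F` that vanish on the divisor, i.e. for which `F(ξ / ξ_j)` has positive
order at `v`, where the `j`-th chart is one that meets the divisor. -/
def divisorIdeal (v : Valuation K ℤᵐ⁰) : Ideal (MvPolynomial (Fin (V.M + 1)) k) :=
  Ideal.span {F | (∃ n : ℕ, F.IsHomogeneous n) ∧
    ∃ j : Fin (V.M + 1), V.ξ j ≠ 0 ∧ (∀ l, v (V.ξ l / V.ξ j) ≤ 1) ∧
      v (MvPolynomial.aeval (fun l => V.ξ l / V.ξ j) F) < 1}

/-- The projective degree of the irreducible divisor to which `v ∈ M_K` is associated. -/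
def deg (v : Valuation K ℤᵐ⁰) : ℚ := projectiveDegree (V.divisorIdeal v)

end NormalProjectiveModel

/-! ### Curves -/

/-- The closed points of the nonsingular projective curve over `Fq` with function field `F` are the
places of `F`, i.e. the proper valuation rings of `F` that contain `Fq`; the valuation ring is the
local ring of the point. -/
def IsPlace (Fq : Type*) {F : Type*} [Field Fq] [Field F] [Algebra Fq F]
    (P : ValuationSubring F) : Prop :=
  P ≠ ⊤ ∧ ∀ c : Fq, algebraMap Fq F c ∈ P

/-- The ring of functions on the curve that are regular everywhere except possibly at `inf`. -/
def regularAway (Fq : Type*) {F : Type*} [Field Fq] [Field F] [Algebra Fq F]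
    (inf : ValuationSubring F) : Subalgebra Fq F where
  carrier := {y | ∀ P : ValuationSubring F, IsPlace Fq P → P ≠ inf → y ∈ P}
  mul_mem' ha hb P hP hne := mul_mem (ha P hP hne) (hb P hP hne)
  add_mem' ha hb P hP hne := add_mem (ha P hP hne) (hb P hP hne)
  algebraMap_mem' c _ hP _ := hP.2 c

/-- A valuation `w` of an extension `L` of `K` lies above the place `inf` of the fraction field of
`A = regularAway Fq inf`, where `A` is embedded in `K` by `i`: the valuation ring of the
restriction of `w` to `Frac A` is that of `inf`. -/
def LiesAboveInfinity {Fq F K L : Type*} [Field Fq] [Field F] [Algebra Fq F] [Field K]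
    [Algebra Fq K] [Field L] [Algebra K L] {inf : ValuationSubring F}
    (i : regularAway Fq inf →ₐ[Fq] K) (w : Valuation L ℤᵐ⁰) : Prop :=
  ∀ a b : regularAway Fq inf, b ≠ 0 →
    (w (algebraMap K L (i a)) ≤ w (algebraMap K L (i b)) ↔ (a : F) / (b : F) ∈ inf)

/-! ### Twisted polynomials and Drinfeld modules -/

/-- The ring `K{τ}` of twisted polynomials, with `τ c = c ^ q τ` where `q` is the number of
elements of `Fq`. -/
def TwistedPoly (Fq K : Type*) [Field Fq] [Fintype Fq] [Field K] [Algebra Fq K] : Type _ :=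
  SkewPolynomial K

namespace TwistedPoly

variable {Fq K : Type*} [Field Fq] [Fintype Fq] [Field K] [Algebra Fq K]

/-- The action of `ℕ` on `K` by the powers of `c ↦ c ^ q`. -/
@[reducible] def frobeniusAction (Fq K : Type*) [Field Fq] [Fintype Fq] [Field K] [Algebra Fq K] :
    MulSemiringAction (Multiplicative ℕ) K :=
  MulSemiringAction.compHom K
    (powersHom (K →+* K) (FiniteField.frobeniusAlgHom Fq K).toRingHom)

instance : Ring (TwistedPoly Fq K) :=
  letI := frobeniusAction Fq K
  inferInstanceAs (Ring (SkewPolynomial K))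

/-- The coefficient of `τ ^ n`. -/
def coeff (P : TwistedPoly Fq K) (n : ℕ) : K := SkewPolynomial.coeff P n

/-- The degree in `τ` (`0` for the zero polynomial). -/
def tauDegree (P : TwistedPoly Fq K) : ℕ := (SkewPolynomial.support P).sup id

/-- The value `∑ a_n y ^ (q ^ n)` of `∑ a_n τ ^ n` at an element `y` of an extension of `K`. -/
def eval {L : Type*} [Field L] [Algebra K L] (P : TwistedPoly Fq K) (y : L) : L :=
  ∑ n ∈ SkewPolynomial.support P, algebraMap K L (P.coeff n) * y ^ (Fintype.card Fq ^ n)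

end TwistedPoly

/-- A Drinfeld module over `K` for `i : A → K`. (Such a morphism automatically sends every
constant `c ∈ Fq` to the constant twisted polynomial `c`.) -/
structure DrinfeldModule {Fq A K : Type*} [Field Fq] [Fintype Fq] [CommRing A] [Algebra Fq A]
    [Field K] [Algebra Fq K] (i : A →ₐ[Fq] K) where
  /-- the morphism `a ↦ φ_a` -/
  toRingHom : A →+* TwistedPoly Fq K
  coeff_zero : ∀ a, (toRingHom a).coeff 0 = i a

namespace DrinfeldModule

variable {Fq A K : Type*} [Field Fq] [Fintype Fq] [CommRing A] [Algebra Fq A]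
  [Field K] [Algebra Fq K] {i : A →ₐ[Fq] K}

/-- `V_w(y) = lim_n min {0, w(φ_{a^n}(y))} / deg φ_{a^n}`, where `deg` is the degree as an ordinary
polynomial, `q` to the power the degree in `τ`. -/
def localLimit (φ : DrinfeldModule i) (a : A) {L : Type*} [Field L] [Algebra K L]
    (w : Valuation L ℤᵐ⁰) (y : L) : ℝ :=
  Filter.limUnder Filter.atTop fun n : ℕ =>
    (ordMinus w ((φ.toRingHom (a ^ n)).eval y) : ℝ) /
      (Fintype.card Fq : ℝ) ^ (φ.toRingHom (a ^ n)).tauDegree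

/-- The local height `ĥ_w(y) = -(deg(v) f(w|v) / [L : K]) V_w(y)` of `y ∈ L` at `w ∈ M_L`, where
`w` extends `v ∈ M_K`; `a` is any nonconstant element of `A`. -/
def localHeight (φ : DrinfeldModule i) (a : A) {k : Type*} [Field k] [Algebra k K]
    (V : NormalProjectiveModel k K) {L : Type*} [Field L] [Algebra K L]
    (v : Valuation K ℤᵐ⁰) (w : Valuation L ℤᵐ⁰) [v.HasExtension w] (y : L) : ℝ :=
  -((V.deg v : ℝ) * (residueDegree v w : ℝ) / (Module.finrank K L : ℝ)) * φ.localLimit a w y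

end DrinfeldModule

end

/-! The theorem is about the dynamics of one twisted polynomial `P = φ_s` at the place `v`. Here `s`
is a nonconstant element for which `φ_s` has least degree in `τ`, so everything depending on `s`
depends on `φ` only. Let `N` bound the orders of the coefficients of `P` at all places of `K`; it
exists because an element of `K` has only finitely many zeros and poles. At `v` these orders are
multiplied by `e`. Write `V` for the local limit and `D` for the product of the `q ^ k - 1`, `1 ≤ k
≤ deg P`.

Away from infinity the constant coefficient of `P` is integral, so some disc around the origin is
stable under `P`; on it `V = 0`. Let the depth of a point be its distance outside that disc,
measured in orders scaled by `D`. If the terms of `P(y)` do not cancel, one application of `P`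
multiplies the depth by at least `q ^ r₀`. Once the depth exceeds `3NDe` the top term dominates for
ever and `-V ≥ Ne`. Each application multiplies `V` by `q ^ r`, so it suffices to bound the number
of steps needed to escape.

If `e` does not divide `D · ord y`, two terms of `P(y)` cannot have equal order, because `e` is
prime to `q`; the property passes to `P(y)`, and cancellation never occurs
(`TameSetup.noCancel_iterate`). The depth starts at 1 or more, so escape takes about `log (3NDe) /
log (q ^ r₀)` steps. This costs a factor of order `e ^ (r / r₀)` against the gain `Ne`, which is the
exponent claimed (`neg_localLimit_ge_of_not_dvd`).

Otherwise `x` is replaced by the points `φ_g(x)`, with `g` a polynomial in `s` of degree less than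
`m`. If one of them has order outside the divisible case, the previous argument applies to it. If
none does and none has escaped, all differences of these points have orders in a set of at most
`3ND` values. Pigeonhole in an ultrametric space gives a large equidistant subset, and counting
roots over the residue field gives a difference with no cancellation during `n₀` steps
(`exists_sub_noCancel`). Its depth is a positive multiple of `e`, so a number of steps independent
of `e` is enough (`exists_polyIn_escape`). Passing from `x` to `φ_g(x)` changes `V` by a bounded
factor. -/

noncomputable section

/-! ### Twisted polynomials: coefficients, degree, evaluation as composition. -/

namespace TwistedPoly

variable {Fq K : Type*} [Field Fq] [Fintype Fq] [Field K] [Algebra Fq K]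

lemma frobeniusAction_smul (n : ℕ) (c : K) :
    (frobeniusAction Fq K).smul (Multiplicative.ofAdd n) c = c ^ (Fintype.card Fq ^ n) := by
  let _ := frobeniusAction Fq K
  change Multiplicative.ofAdd n • c = _
  induction n with
  | zero => simp
  | succ n ih =>
    change Multiplicative.ofAdd n • c = _ at ih
    rw [add_comm, ofAdd_add, mul_smul, ih]
    change (powersHom (K →+* K) (FiniteField.frobeniusAlgHom Fq K).toRingHom
      (Multiplicative.ofAdd 1)) _ = _
    simp [pow_add, ← pow_mul, mul_comm]

@[simp] lemma coeff_zero' (n : ℕ) : (0 : TwistedPoly Fq K).coeff n = 0 := rfl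

@[simp] lemma coeff_add (P Q : TwistedPoly Fq K) (n : ℕ) :
    (P + Q).coeff n = P.coeff n + Q.coeff n := by
  exact congrArg (fun f => f (Multiplicative.ofAdd n))
    (SkewMonoidAlgebra.coeff_add (k := K) (G := Multiplicative ℕ) P Q)

lemma coeff_one (n : ℕ) : (1 : TwistedPoly Fq K).coeff n = if n = 0 then 1 else 0 := by
  let _ := frobeniusAction Fq K
  have := SkewPolynomial.coeff_one (R := K) n
  simp only [eq_comm (a := 0)] at this
  exact this

lemma mem_support {P : TwistedPoly Fq K} {n : ℕ} :
    n ∈ SkewPolynomial.support P ↔ P.coeff n ≠ 0 := SkewPolynomial.mem_support_iff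

lemma coeff_mul (P Q : TwistedPoly Fq K) (n : ℕ) :
    (P * Q).coeff n =
      ∑ ij ∈ Finset.HasAntidiagonal.antidiagonal n,
        P.coeff ij.1 * Q.coeff ij.2 ^ (Fintype.card Fq ^ ij.1) := by
  let _ := frobeniusAction Fq K
  have := SkewMonoidAlgebra.coeff_mul_antidiagonal_of_finset (k := K) (G := Multiplicative ℕ) P Q
    (Multiplicative.ofAdd n) ((Finset.HasAntidiagonal.antidiagonal n).map
      ⟨fun ij => (Multiplicative.ofAdd ij.1, Multiplicative.ofAdd ij.2), fun a b h => h⟩) (by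
      rintro ⟨a, b⟩
      simp only [Finset.mem_map, Finset.HasAntidiagonal.mem_antidiagonal]
      constructor
      · rintro ⟨⟨i, j⟩, h, h'⟩
        obtain ⟨rfl, rfl⟩ := Prod.mk.inj h'
        exact congrArg Multiplicative.ofAdd h
      · intro h
        exact ⟨(Multiplicative.toAdd a, Multiplicative.toAdd b), h, rfl⟩)
  refine this.trans ?_
  rw [Finset.sum_map]
  refine Finset.sum_congr rfl fun ij _ => ?_
  have h := frobeniusAction_smul (Fq := Fq) ij.1
    (SkewMonoidAlgebra.coeff (k := K) Q (Multiplicative.ofAdd ij.2))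
  exact congrArg _ h

lemma coeff_eq_zero_of_lt {P : TwistedPoly Fq K} {n : ℕ} (h : P.tauDegree < n) :
    P.coeff n = 0 := by
  by_contra hn
  exact absurd (Finset.le_sup (f := id) (mem_support.2 hn)) (not_le.2 h)

lemma le_tauDegree {P : TwistedPoly Fq K} {n : ℕ} (h : P.coeff n ≠ 0) : n ≤ P.tauDegree :=
  not_lt.1 fun hn => h (coeff_eq_zero_of_lt hn)

lemma tauDegree_le {P : TwistedPoly Fq K} {n : ℕ} (h : ∀ m, n < m → P.coeff m = 0) :
    P.tauDegree ≤ n :=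
  Finset.sup_le fun m hm => not_lt.1 fun hn => mem_support.1 hm (h m hn)

lemma coeff_tauDegree_ne_zero {P : TwistedPoly Fq K} (h : P ≠ 0) : P.coeff P.tauDegree ≠ 0 := by
  have hne : (SkewPolynomial.support P).Nonempty := by
    rw [Finset.nonempty_iff_ne_empty]
    exact fun h' => h (SkewPolynomial.support_eq_empty.1 h')
  obtain ⟨n, hn, h'⟩ := Finset.exists_mem_eq_sup _ hne id
  unfold tauDegree
  rw [h']
  exact mem_support.1 hn

lemma coeff_mul_tauDegree (P Q : TwistedPoly Fq K) :
    (P * Q).coeff (P.tauDegree + Q.tauDegree) =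
      P.coeff P.tauDegree * Q.coeff Q.tauDegree ^ (Fintype.card Fq ^ P.tauDegree) := by
  rw [coeff_mul, Finset.sum_eq_single (P.tauDegree, Q.tauDegree)]
  · rintro ⟨i, j⟩ hij hne
    rw [Finset.HasAntidiagonal.mem_antidiagonal] at hij
    rcases lt_trichotomy i P.tauDegree with h | h | h
    · rw [coeff_eq_zero_of_lt (P := Q) (n := j) (by simp at hij; omega),
        zero_pow (by positivity), mul_zero]
    · exact absurd (Prod.ext h (by simp at hij ⊢; omega)) hne
    · rw [coeff_eq_zero_of_lt h, zero_mul]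
  · simp

lemma tauDegree_mul_le (P Q : TwistedPoly Fq K) :
    (P * Q).tauDegree ≤ P.tauDegree + Q.tauDegree := by
  refine tauDegree_le fun m hm => ?_
  rw [coeff_mul]
  refine Finset.sum_eq_zero fun ij hij => ?_
  rw [Finset.HasAntidiagonal.mem_antidiagonal] at hij
  rcases le_or_gt ij.1 P.tauDegree with h | h
  · rw [coeff_eq_zero_of_lt (P := Q) (n := ij.2) (by omega),
        zero_pow (by positivity), mul_zero]
  · rw [coeff_eq_zero_of_lt h, zero_mul]

lemma mul_ne_zero' {P Q : TwistedPoly Fq K} (hP : P ≠ 0) (hQ : Q ≠ 0) : P * Q ≠ 0 := by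
  intro h
  have := coeff_mul_tauDegree P Q
  rw [h, coeff_zero'] at this
  exact mul_ne_zero (coeff_tauDegree_ne_zero hP) (pow_ne_zero _ (coeff_tauDegree_ne_zero hQ))
    this.symm

lemma tauDegree_mul {P Q : TwistedPoly Fq K} (hP : P ≠ 0) (hQ : Q ≠ 0) :
    (P * Q).tauDegree = P.tauDegree + Q.tauDegree := by
  refine (tauDegree_mul_le P Q).antisymm (le_tauDegree ?_)
  rw [coeff_mul_tauDegree]
  exact mul_ne_zero (coeff_tauDegree_ne_zero hP) (pow_ne_zero _ (coeff_tauDegree_ne_zero hQ))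

lemma tauDegree_one : (1 : TwistedPoly Fq K).tauDegree = 0 :=
  Nat.le_zero.1 <| tauDegree_le fun m hm => by rw [coeff_one, if_neg hm.ne']

lemma one_ne_zero' : (1 : TwistedPoly Fq K) ≠ 0 := fun h => by
  simpa [coeff_one] using congrArg (fun P => coeff P 0) h

lemma pow_ne_zero' {P : TwistedPoly Fq K} (hP : P ≠ 0) (n : ℕ) : P ^ n ≠ 0 := by
  induction n with
  | zero => rw [pow_zero]; exact one_ne_zero'
  | succ n ih => rw [pow_succ]; exact mul_ne_zero' ih hP

lemma tauDegree_pow {P : TwistedPoly Fq K} (hP : P ≠ 0) (n : ℕ) :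
    (P ^ n).tauDegree = n * P.tauDegree := by
  induction n with
  | zero => rw [pow_zero, tauDegree_one, zero_mul]
  | succ n ih => rw [pow_succ, tauDegree_mul (pow_ne_zero' hP n) hP, ih]; ring

section eval

variable {L : Type*} [Field L] [Algebra K L]

lemma eval_eq_sum_range {P : TwistedPoly Fq K} {N : ℕ} (hN : P.tauDegree < N) (y : L) :
    P.eval y =
      ∑ n ∈ Finset.range N, algebraMap K L (P.coeff n) * y ^ (Fintype.card Fq ^ n) := by
  refine Finset.sum_subset (fun n hn => ?_) fun n _ hn => ?_
  · exact Finset.mem_range.2 ((le_tauDegree (mem_support.1 hn)).trans_lt hN)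
  · rw [mem_support, not_not] at hn
    rw [hn, map_zero, zero_mul]

lemma eval_add (P Q : TwistedPoly Fq K) (y : L) : (P + Q).eval y = P.eval y + Q.eval y := by
  obtain ⟨N, hN⟩ := exists_gt (max (max P.tauDegree Q.tauDegree) (P + Q).tauDegree)
  simp only [max_lt_iff] at hN
  rw [eval_eq_sum_range hN.2, eval_eq_sum_range hN.1.1, eval_eq_sum_range hN.1.2,
    ← Finset.sum_add_distrib]
  simp [add_mul]

lemma eval_sub (P Q : TwistedPoly Fq K) (y : L) : (P - Q).eval y = P.eval y - Q.eval y := by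
  rw [eq_sub_iff_add_eq, ← eval_add, sub_add_cancel]

lemma sum_pow_card (Fq K : Type*) {L : Type*} [Field Fq] [Fintype Fq] [Field K] [Algebra Fq K]
    [Field L] [Algebra K L] {ι : Type*} (s : Finset ι) (f : ι → L) (n : ℕ) :
    (∑ i ∈ s, f i) ^ (Fintype.card Fq ^ n) = ∑ i ∈ s, f i ^ (Fintype.card Fq ^ n) := by
  let _ : Algebra Fq L := ((algebraMap K L).comp (algebraMap Fq K)).toAlgebra
  have h : ∀ y : L, ((FiniteField.frobeniusAlgHom Fq L) ^ n) y = y ^ (Fintype.card Fq ^ n) := by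
    intro y
    induction n generalizing y with
    | zero => simp
    | succ n ih => rw [pow_succ, AlgHom.mul_apply, ih]; simp [pow_succ', pow_mul]
  rw [← h, map_sum]
  exact Finset.sum_congr rfl fun i _ => h _

lemma add_pow_card (Fq K : Type*) {L : Type*} [Field Fq] [Fintype Fq] [Field K] [Algebra Fq K]
    [Field L] [Algebra K L] (x y : L) (n : ℕ) :
    (x + y) ^ (Fintype.card Fq ^ n) = x ^ (Fintype.card Fq ^ n) + y ^ (Fintype.card Fq ^ n) := by
  simpa using sum_pow_card Fq K (Finset.univ : Finset (Fin 2)) ![x, y] n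

lemma eval_map_add (P : TwistedPoly Fq K) (x y : L) : P.eval (x + y) = P.eval x + P.eval y := by
  unfold eval
  rw [← Finset.sum_add_distrib]
  exact Finset.sum_congr rfl fun n _ => by rw [add_pow_card Fq K, mul_add]

lemma eval_map_sub (P : TwistedPoly Fq K) (x y : L) : P.eval (x - y) = P.eval x - P.eval y := by
  rw [eq_sub_iff_add_eq, ← eval_map_add, sub_add_cancel]

lemma eval_map_zero (P : TwistedPoly Fq K) : P.eval (0 : L) = 0 := by
  simpa using P.eval_map_sub (0 : L) 0

lemma eval_one (y : L) : (1 : TwistedPoly Fq K).eval y = y := by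
  rw [eval_eq_sum_range (N := 1) (by rw [tauDegree_one]; exact one_pos)]
  simp [coeff_one]

lemma eval_mul (P Q : TwistedPoly Fq K) (y : L) : (P * Q).eval y = P.eval (Q.eval y) := by
  obtain ⟨N, hN⟩ := exists_gt (P.tauDegree + Q.tauDegree)
  rw [eval_eq_sum_range ((tauDegree_mul_le P Q).trans_lt hN),
    eval_eq_sum_range (P := P) (N := N) (by omega),
    eval_eq_sum_range (P := Q) (N := N) (by omega)]
  simp only [coeff_mul, map_sum, sum_pow_card Fq K, map_mul, map_pow, mul_pow, Finset.mul_sum,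
    Finset.sum_mul]
  rw [← Finset.sum_product', Finset.sum_sigma']
  refine Finset.sum_bij_ne_zero (fun a _ _ => a.2) ?_ ?_ ?_ ?_
  · rintro ⟨n, i, j⟩ h _
    simp at h ⊢
    omega
  · rintro ⟨n, i, j⟩ h _ ⟨n', i', j'⟩ h' _ heq
    simp at h h' heq
    obtain ⟨rfl, rfl⟩ := heq
    obtain ⟨-, rfl⟩ := h
    obtain ⟨-, rfl⟩ := h'
    rfl
  · rintro ⟨i, j⟩ h hne
    have hi : P.coeff i ≠ 0 := fun h => hne (by simp [h])
    have hj : Q.coeff j ≠ 0 := fun h => hne (by simp [h])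
    have := le_tauDegree hi
    have := le_tauDegree hj
    have e : algebraMap K L (P.coeff i) * algebraMap K L (Q.coeff j) ^ (Fintype.card Fq ^ i) *
        y ^ (Fintype.card Fq ^ (i + j)) ≠ 0 := by
      convert! hne using 1
      simp only
      ring
    exact ⟨⟨i + j, i, j⟩, by simp; omega, e, rfl⟩
  · rintro ⟨n, i, j⟩ h _
    simp at h
    simp only [← h.2]
    ring

end eval

end TwistedPoly

/-! ### Additive form of a valuation. -/

section ordAt

variable {L : Type*} [Field L] (v : Valuation L ℤᵐ⁰)

lemma val_eq_exp_neg_ordAt {y : L} (hy : y ≠ 0) : v y = WithZero.exp (-ordAt v y) := by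
  rw [ordAt, neg_neg, WithZero.exp_log (v.ne_zero_iff.2 hy)]

lemma ordAt_zero : ordAt v 0 = 0 := by simp [ordAt]

lemma ordAt_mul {x y : L} (hx : x ≠ 0) (hy : y ≠ 0) :
    ordAt v (x * y) = ordAt v x + ordAt v y := by
  rw [ordAt, map_mul, WithZero.log_mul (v.ne_zero_iff.2 hx) (v.ne_zero_iff.2 hy), neg_add]
  rfl

lemma ordAt_pow (x : L) (n : ℕ) : ordAt v (x ^ n) = n * ordAt v x := by
  rw [ordAt, map_pow, WithZero.log_pow, ordAt]
  simp

lemma ordAt_inv (x : L) : ordAt v x⁻¹ = -ordAt v x := by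
  rw [ordAt, map_inv₀, WithZero.log_inv, ordAt]

lemma ordAt_div {x y : L} (hx : x ≠ 0) (hy : y ≠ 0) :
    ordAt v (x / y) = ordAt v x - ordAt v y := by
  rw [div_eq_mul_inv, ordAt_mul v hx (inv_ne_zero hy), ordAt_inv, sub_eq_add_neg]

lemma ordAt_neg (x : L) : ordAt v (-x) = ordAt v x := by
  rw [ordAt, Valuation.map_neg, ordAt]

lemma val_le_exp_iff {y : L} (hy : y ≠ 0) {n : ℤ} : v y ≤ WithZero.exp (-n) ↔ n ≤ ordAt v y := by
  rw [val_eq_exp_neg_ordAt v hy, WithZero.exp_le_exp, neg_le_neg_iff]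

lemma val_lt_exp_iff {y : L} (hy : y ≠ 0) {n : ℤ} : v y < WithZero.exp (-n) ↔ n < ordAt v y := by
  rw [val_eq_exp_neg_ordAt v hy, WithZero.exp_lt_exp, neg_lt_neg_iff]

lemma val_le_one_iff {y : L} (hy : y ≠ 0) : v y ≤ 1 ↔ 0 ≤ ordAt v y := by
  simpa using val_le_exp_iff v hy (n := 0)

lemma val_lt_one_iff {y : L} (hy : y ≠ 0) : v y < 1 ↔ 0 < ordAt v y := by
  simpa using val_lt_exp_iff v hy (n := 0)

lemma ordMinus_nonpos (y : L) : ordMinus v y ≤ 0 := min_le_left _ _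

lemma ordMinus_eq_ordAt {y : L} (hy : ordAt v y ≤ 0) : ordMinus v y = ordAt v y :=
  min_eq_right hy

end ordAt

/-! ### Orders of the values of a twisted polynomial. -/

namespace TwistedPoly

variable {Fq K : Type*} [Field Fq] [Fintype Fq] [Field K] [Algebra Fq K]
  {L : Type*} [Field L] [Algebra K L] (v : Valuation L ℤᵐ⁰)

/-- The order of the `i`-th term of `P.eval y`, when the `i`-th coefficient and `y` are nonzero. -/
def termOrd (P : TwistedPoly Fq K) (y : L) (i : ℕ) : ℤ :=
  ordAt v (algebraMap K L (P.coeff i)) + (Fintype.card Fq : ℤ) ^ i * ordAt v y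

lemma val_term {P : TwistedPoly Fq K} {y : L} (hy : y ≠ 0) {i : ℕ} (hi : P.coeff i ≠ 0) :
    v (algebraMap K L (P.coeff i) * y ^ (Fintype.card Fq ^ i)) =
      WithZero.exp (-termOrd v P y i) := by
  have hi' : algebraMap K L (P.coeff i) ≠ 0 := by simpa using hi
  rw [val_eq_exp_neg_ordAt v (mul_ne_zero hi' (pow_ne_zero _ hy)),
    ordAt_mul v hi' (pow_ne_zero _ hy), ordAt_pow]
  simp [termOrd]

lemma val_eval_le {P : TwistedPoly Fq K} {y : L} (hy : y ≠ 0) {m : ℤ}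
    (hm : ∀ i, P.coeff i ≠ 0 → m ≤ termOrd v P y i) : v (P.eval y) ≤ WithZero.exp (-m) := by
  refine v.map_sum_le fun i hi => ?_
  rw [val_term v hy (mem_support.1 hi), WithZero.exp_le_exp]
  exact neg_le_neg (hm i (mem_support.1 hi))

lemma ordAt_eval_of_unique_min {P : TwistedPoly Fq K} {y : L} (hy : y ≠ 0) {j : ℕ}
    (hj : P.coeff j ≠ 0)
    (h : ∀ i, P.coeff i ≠ 0 → i ≠ j → termOrd v P y j < termOrd v P y i) :
    P.eval y ≠ 0 ∧ ordAt v (P.eval y) = termOrd v P y j := by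
  have := v.map_sum_eq_of_lt (s := SkewPolynomial.support P)
    (f := fun n => algebraMap K L (P.coeff n) * y ^ (Fintype.card Fq ^ n))
    (mem_support.2 hj) fun i hi => by
      simp only [Finset.mem_sdiff, Finset.mem_singleton] at hi
      rw [val_term v hy (mem_support.1 hi.1), val_term v hy hj, WithZero.exp_lt_exp]
      exact neg_lt_neg (h i (mem_support.1 hi.1) hi.2)
  rw [val_term v hy hj] at this
  change v (P.eval y) = _ at this
  refine ⟨fun h0 => ?_, ?_⟩
  · rw [h0, map_zero] at this
    exact WithZero.exp_ne_zero this.symm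
  · rw [ordAt, this, WithZero.log_exp, neg_neg]

variable (Fq) in
lemma two_le_card : (2 : ℤ) ≤ Fintype.card Fq := by
  exact_mod_cast Fintype.one_lt_card (α := Fq)

variable (Fq) in
lemma one_le_card_pow (n : ℕ) : (1 : ℤ) ≤ (Fintype.card Fq : ℤ) ^ n :=
  one_le_pow₀ (by linarith [two_le_card Fq])

/-- `B` bounds the orders of the nonzero coefficients of `P`. -/
def CoeffBound (L : Type*) [Field L] [Algebra K L] (v : Valuation L ℤᵐ⁰)
    (P : TwistedPoly Fq K) (B : ℤ) : Prop :=
  ∀ i, P.coeff i ≠ 0 → |ordAt v (algebraMap K L (P.coeff i))| ≤ B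

lemma exists_coeffBound (P : TwistedPoly Fq K) : ∃ B : ℤ, 0 ≤ B ∧ CoeffBound L v P B := by
  refine ⟨∑ i ∈ SkewPolynomial.support P, |ordAt v (algebraMap K L (P.coeff i))|,
    Finset.sum_nonneg fun _ _ => abs_nonneg _, fun i hi => ?_⟩
  exact Finset.single_le_sum (f := fun i => |ordAt v (algebraMap K L (P.coeff i))|)
    (fun _ _ => abs_nonneg _) (mem_support.2 hi)

/-- Two coefficient orders differ by at most `2B`, while the exponents `q ^ i` differ by at least 1;
so below `-2B` the top term is the unique smallest one. -/
lemma ordAt_eval_of_lt {P : TwistedPoly Fq K} {B : ℤ} (hP : CoeffBound L v P B) (h0 : P ≠ 0)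
    {y : L} (hy : ordAt v y < -2 * B) :
    P.eval y ≠ 0 ∧ ordAt v (P.eval y) = termOrd v P y P.tauDegree := by
  have hB : 0 ≤ B := (abs_nonneg _).trans (hP _ (coeff_tauDegree_ne_zero h0))
  have hy0 : y ≠ 0 := by
    rintro rfl
    rw [ordAt_zero] at hy
    linarith
  refine ordAt_eval_of_unique_min v hy0 (coeff_tauDegree_ne_zero h0) fun i hi hne => ?_
  have h1 := abs_le.1 (hP _ hi)
  have h2 := abs_le.1 (hP _ (coeff_tauDegree_ne_zero h0))
  have hlt : i < P.tauDegree := lt_of_le_of_ne (le_tauDegree hi) hne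
  have h3 : (Fintype.card Fq : ℤ) ^ i + 1 ≤ (Fintype.card Fq : ℤ) ^ P.tauDegree :=
    Int.add_one_le_iff.2 (pow_lt_pow_right₀ (by linarith [two_le_card Fq]) hlt)
  unfold termOrd
  nlinarith

/-- Below `-2B` the top term decides and the error is the order of its coefficient; above `-2B` both
quantities are bounded. -/
lemma ordMinus_eval_sub_le (P : TwistedPoly Fq K) (h0 : P ≠ 0) :
    ∃ C : ℤ, 0 ≤ C ∧ ∀ y : L,
      |ordMinus v (P.eval y) - (Fintype.card Fq : ℤ) ^ P.tauDegree * ordMinus v y| ≤ C := by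
  obtain ⟨B, hB, hP⟩ := exists_coeffBound (L := L) v P
  have hd := one_le_card_pow Fq P.tauDegree
  set Q := (Fintype.card Fq : ℤ) ^ P.tauDegree with hQ
  refine ⟨B + Q * (2 * B), by positivity, fun y => ?_⟩
  rcases lt_or_ge (ordAt v y) (-2 * B) with h | h
  · have h1 := (ordAt_eval_of_lt v hP h0 h).2
    have h2 := abs_le.1 (hP _ (coeff_tauDegree_ne_zero h0))
    rw [termOrd, ← hQ] at h1
    rw [ordMinus_eq_ordAt v (y := y) (by linarith), ordMinus_eq_ordAt v (by nlinarith), h1,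
      add_sub_cancel_right, abs_le]
    constructor <;> nlinarith
  · have h1 : -(2 * B) ≤ ordMinus v y := le_min (by linarith) (by linarith)
    have h2 := ordMinus_nonpos v y
    have h3 : -(B + Q * (2 * B)) ≤ ordMinus v (P.eval y) := by
      refine le_min (by nlinarith) ?_
      rcases eq_or_ne (P.eval y) 0 with h' | h'
      · rw [h', ordAt_zero]; nlinarith
      rw [← val_le_exp_iff v h']
      have hy : y ≠ 0 := fun hy => h' (by rw [hy, eval_map_zero])
      refine val_eval_le v hy fun i hi => ?_
      have h4 := abs_le.1 (hP _ hi)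
      have h5 : (Fintype.card Fq : ℤ) ^ i ≤ Q :=
        pow_le_pow_right₀ (by linarith [two_le_card Fq]) (le_tauDegree hi)
      have h6 := one_le_card_pow Fq i
      unfold termOrd
      nlinarith
    have h4 := ordMinus_nonpos v (P.eval y)
    rw [abs_le]
    constructor <;> nlinarith

end TwistedPoly

/-! ### The local limit: existence, functional equation, independence of the element chosen. -/

namespace DrinfeldModule

open Filter Topology

variable {Fq A K : Type*} [Field Fq] [Fintype Fq] [CommRing A] [Algebra Fq A]
  [Field K] [Algebra Fq K] {i : A →ₐ[Fq] K} (φ : DrinfeldModule i)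
  {L : Type*} [Field L] [Algebra K L] (v : Valuation L ℤᵐ⁰)

/-- The sequence whose limit is `φ.localLimit a v y`. -/
def localSeq (a : A) (y : L) (n : ℕ) : ℝ :=
  (ordMinus v ((φ.toRingHom (a ^ n)).eval y) : ℝ) /
      (Fintype.card Fq : ℝ) ^ (φ.toRingHom (a ^ n)).tauDegree

lemma ne_zero_of_tauDegree_pos {P : TwistedPoly Fq K} (h : 0 < P.tauDegree) : P ≠ 0 := by
  rintro rfl
  exact absurd h (not_lt.2 (TwistedPoly.tauDegree_le fun _ _ => rfl))

lemma eval_pow_succ (a : A) (y : L) (n : ℕ) :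
    (φ.toRingHom (a ^ (n + 1))).eval y =
      (φ.toRingHom a).eval ((φ.toRingHom (a ^ n)).eval y) := by
  rw [pow_succ', map_mul, TwistedPoly.eval_mul]

lemma tauDegree_pow {a : A} (ha : 0 < (φ.toRingHom a).tauDegree) (n : ℕ) :
    (φ.toRingHom (a ^ n)).tauDegree = n * (φ.toRingHom a).tauDegree := by
  rw [map_pow, TwistedPoly.tauDegree_pow (ne_zero_of_tauDegree_pos ha)]

lemma one_lt_card_real : (1 : ℝ) < Fintype.card Fq := by
  exact_mod_cast Fintype.one_lt_card (α := Fq)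

/-- Tate's telescoping argument: consecutive terms differ by at most `C / q ^ ((n + 1) d)`, a
geometric series. The constant is uniform in `y`, which `localLimit_eq` needs. -/
lemma exists_tendsto_localSeq {a : A} (ha : 0 < (φ.toRingHom a).tauDegree) :
    ∃ C : ℝ, ∀ y : L, Tendsto (φ.localSeq v a y) atTop (𝓝 (φ.localLimit a v y)) ∧
      |ordMinus v y - φ.localLimit a v y| ≤ C := by
  obtain ⟨C, hC, h⟩ := (φ.toRingHom a).ordMinus_eval_sub_le (L := L) v
    (ne_zero_of_tauDegree_pos ha)
  set d := (φ.toRingHom a).tauDegree with hd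
  have hq := one_lt_card_real (Fq := Fq)
  set q : ℝ := (Fintype.card Fq : ℝ) with hqdef
  have hqd : 1 < q ^ d := one_lt_pow₀ hq ha.ne'
  have hr : (q ^ d)⁻¹ < 1 := inv_lt_one_of_one_lt₀ hqd
  refine ⟨(C / q ^ d) / (1 - (q ^ d)⁻¹), fun y => ?_⟩
  have hseq : ∀ n, dist (φ.localSeq v a y n) (φ.localSeq v a y (n + 1)) ≤
      (C / q ^ d) * (q ^ d)⁻¹ ^ n := by
    intro n
    have h1 := h ((φ.toRingHom (a ^ n)).eval y)
    rw [← eval_pow_succ] at h1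
    have h2 : |(ordMinus v ((φ.toRingHom (a ^ (n + 1))).eval y) : ℝ) -
        q ^ d * ordMinus v ((φ.toRingHom (a ^ n)).eval y)| ≤ C := by
      rw [hqdef]
      exact_mod_cast h1
    have hpos : 0 < q ^ ((n + 1) * d) := by positivity
    rw [localSeq, localSeq, tauDegree_pow φ ha, tauDegree_pow φ ha, ← hd, ← hqdef, Real.dist_eq,
      abs_sub_comm]
    have : ((ordMinus v ((φ.toRingHom (a ^ (n + 1))).eval y) : ℝ) / q ^ ((n + 1) * d) -
        ordMinus v ((φ.toRingHom (a ^ n)).eval y) / q ^ (n * d)) =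
        ((ordMinus v ((φ.toRingHom (a ^ (n + 1))).eval y) : ℝ) -
        q ^ d * ordMinus v ((φ.toRingHom (a ^ n)).eval y)) / q ^ ((n + 1) * d) := by
      rw [add_mul, one_mul, pow_add q]
      field_simp
    rw [this, abs_div, abs_of_pos hpos]
    calc _ ≤ C / q ^ ((n + 1) * d) := by gcongr
      _ = _ := by
        rw [add_mul, one_mul, pow_add, inv_pow, ← pow_mul, mul_comm n d]
        field_simp
  obtain ⟨l, hl⟩ := cauchySeq_tendsto_of_complete (cauchySeq_of_le_geometric _ _ hr hseq)
  have hlim : φ.localLimit a v y = l := hl.limUnder_eq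
  rw [hlim]
  refine ⟨hl, ?_⟩
  have := dist_le_of_le_geometric_of_tendsto₀ _ _ hr hseq hl
  have h0 : φ.localSeq v a y 0 = ordMinus v y := by
    simp [localSeq, TwistedPoly.eval_one, TwistedPoly.tauDegree_one]
  rwa [h0, Real.dist_eq] at this

lemma tendsto_localSeq {a : A} (ha : 0 < (φ.toRingHom a).tauDegree) (y : L) :
    Tendsto (φ.localSeq v a y) atTop (𝓝 (φ.localLimit a v y)) := by
  obtain ⟨C, hC⟩ := φ.exists_tendsto_localSeq v ha
  exact (hC y).1

lemma tendsto_const_div_pow {d : ℕ} (hd : 0 < d) (C : ℝ) :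
    Tendsto (fun n : ℕ => C / (Fintype.card Fq : ℝ) ^ (n * d)) atTop (𝓝 0) := by
  have hq := one_lt_card_real (Fq := Fq)
  have : Tendsto (fun n : ℕ => (Fintype.card Fq : ℝ) ^ (n * d)) atTop atTop := by
    simp_rw [mul_comm _ d, pow_mul]
    exact tendsto_pow_atTop_atTop_of_one_lt (one_lt_pow₀ hq hd.ne')
  exact tendsto_const_nhds.div_atTop this

/-- `φ_b` commutes with every `φ_{a^n}`, so the error made by applying `φ_b` stays bounded along the
orbit and disappears after division. -/
lemma localLimit_eval {a : A} (ha : 0 < (φ.toRingHom a).tauDegree) {b : A}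
    (hb : φ.toRingHom b ≠ 0) (y : L) :
    φ.localLimit a v ((φ.toRingHom b).eval y) =
      (Fintype.card Fq : ℝ) ^ (φ.toRingHom b).tauDegree * φ.localLimit a v y := by
  obtain ⟨C, hC, h⟩ := (φ.toRingHom b).ordMinus_eval_sub_le (L := L) v hb
  have h1 := φ.tendsto_localSeq v ha ((φ.toRingHom b).eval y)
  have h2 := (φ.tendsto_localSeq v ha y).const_mul
    ((Fintype.card Fq : ℝ) ^ (φ.toRingHom b).tauDegree)
  refine sub_eq_zero.1 (tendsto_nhds_unique (h1.sub h2)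
    (squeeze_zero_norm (fun n => ?_) (tendsto_const_div_pow (Fq := Fq) ha C)))
  have h3 := h ((φ.toRingHom (a ^ n)).eval y)
  rw [← TwistedPoly.eval_mul, ← map_mul, mul_comm b, map_mul, TwistedPoly.eval_mul] at h3
  have hq := one_lt_card_real (Fq := Fq)
  rw [localSeq, localSeq, tauDegree_pow φ ha, Real.norm_eq_abs, ← mul_div_assoc, ← sub_div,
    abs_div, abs_of_pos (by positivity : 0 < (Fintype.card Fq : ℝ) ^ _)]
  gcongr
  exact_mod_cast h3

/-- The limit for `a` is within a bounded distance of `ordMinus` and is multiplied by `q ^ deg`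
under `φ_{b^n}`. Evaluating it along the orbit of `b` and dividing gives the limit for `b`. -/
lemma localLimit_eq {a b : A} (ha : 0 < (φ.toRingHom a).tauDegree)
    (hb : 0 < (φ.toRingHom b).tauDegree) (y : L) :
    φ.localLimit a v y = φ.localLimit b v y := by
  obtain ⟨C, hC⟩ := φ.exists_tendsto_localSeq (L := L) v ha
  have hq := one_lt_card_real (Fq := Fq)
  refine (sub_eq_zero.1 (tendsto_nhds_unique ((φ.tendsto_localSeq v hb y).sub
    (tendsto_const_nhds (x := φ.localLimit a v y)))
    (squeeze_zero_norm (fun n => ?_) (tendsto_const_div_pow (Fq := Fq) hb C)))).symm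
  have h1 := (hC ((φ.toRingHom (b ^ n)).eval y)).2
  rw [φ.localLimit_eval v ha (by
    rw [map_pow]; exact TwistedPoly.pow_ne_zero' (ne_zero_of_tauDegree_pos hb) n),
    tauDegree_pow φ hb] at h1
  rw [localSeq, tauDegree_pow φ hb, Real.norm_eq_abs, le_div_iff₀ (by positivity),
    ← abs_of_pos (by positivity : 0 < (Fintype.card Fq : ℝ) ^ (n * (φ.toRingHom b).tauDegree)),
    ← abs_mul, sub_mul, abs_of_pos (by positivity : 0 < (Fintype.card Fq : ℝ) ^ _),
    div_mul_cancel₀ _ (by positivity), mul_comm (φ.localLimit a v y)]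
  exact h1

lemma localLimit_eq_zero_of_bounded {a : A} (ha : 0 < (φ.toRingHom a).tauDegree) {y : L} {m : ℤ}
    (h : ∀ n, m ≤ ordAt v ((φ.toRingHom (a ^ n)).eval y)) : φ.localLimit a v y = 0 := by
  refine tendsto_nhds_unique (φ.tendsto_localSeq v ha y)
    (squeeze_zero_norm (fun n => ?_) (tendsto_const_div_pow (Fq := Fq) ha |(m : ℝ)|))
  have hq := one_lt_card_real (Fq := Fq)
  rw [localSeq, tauDegree_pow φ ha, Real.norm_eq_abs, abs_div,
    abs_of_pos (by positivity : 0 < (Fintype.card Fq : ℝ) ^ _)]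
  refine div_le_div_of_nonneg_right ?_ (by positivity)
  have h1 := ordMinus_nonpos v ((φ.toRingHom (a ^ n)).eval y)
  have h2 : |ordMinus v ((φ.toRingHom (a ^ n)).eval y)| ≤ |m| := by
    rw [abs_of_nonpos h1, neg_le]
    exact le_min (neg_nonpos.2 (abs_nonneg m)) ((neg_abs_le m).trans (h n))
  exact_mod_cast h2

/-- Where the top term dominates, `ord + B` is multiplied by at least the degree `q ^ d ≥ 2` at each
step, so the orbit never returns and the limit is at most `ord y + B`. -/
lemma localLimit_le_of_lt {a : A} (ha : 0 < (φ.toRingHom a).tauDegree) {B : ℤ}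
    (hB : (φ.toRingHom a).CoeffBound L v B) {y : L} (hy : ordAt v y < -2 * B) :
    φ.localLimit a v y ≤ -B := by
  have h0 := ne_zero_of_tauDegree_pos ha
  have hB0 : 0 ≤ B := (abs_nonneg _).trans (hB _ (TwistedPoly.coeff_tauDegree_ne_zero h0))
  have hd : (2 : ℤ) ≤ (Fintype.card Fq : ℤ) ^ (φ.toRingHom a).tauDegree :=
    (TwistedPoly.two_le_card Fq).trans (le_self_pow₀ (by linarith [TwistedPoly.two_le_card Fq]) ha.ne')
  have key : ∀ n, ordAt v ((φ.toRingHom (a ^ n)).eval y) + B ≤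
      (Fintype.card Fq : ℤ) ^ (n * (φ.toRingHom a).tauDegree) * (ordAt v y + B) := by
    intro n
    induction n with
    | zero => simp [TwistedPoly.eval_one]
    | succ n ih =>
      have h1 := TwistedPoly.one_le_card_pow Fq (n * (φ.toRingHom a).tauDegree)
      have hlt : ordAt v ((φ.toRingHom (a ^ n)).eval y) < -2 * B := by nlinarith
      have h2 := (TwistedPoly.ordAt_eval_of_lt v hB h0 hlt).2
      have h3 := (abs_le.1 (hB _ (TwistedPoly.coeff_tauDegree_ne_zero h0))).2
      rw [eval_pow_succ, h2, TwistedPoly.termOrd, add_mul, one_mul, pow_add]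
      nlinarith
  refine le_of_tendsto' (φ.tendsto_localSeq v ha y) fun n => ?_
  have hq := one_lt_card_real (Fq := Fq)
  rw [localSeq, tauDegree_pow φ ha, div_le_iff₀ (by positivity)]
  have h1 := TwistedPoly.one_le_card_pow Fq (n * (φ.toRingHom a).tauDegree)
  have h2 : ordMinus v ((φ.toRingHom (a ^ n)).eval y) ≤
      -B * (Fintype.card Fq : ℤ) ^ (n * (φ.toRingHom a).tauDegree) := by
    refine (min_le_right _ _).trans ?_
    nlinarith [key n]
  exact_mod_cast h2

end DrinfeldModule

/-! ### Integrality of the projective degree. -/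

/-- For a polynomial of degree `D`, the number `D!` times the leading coefficient is its `D`-th
finite difference, here an integral combination of values of the Hilbert function. -/
lemma exists_int_projectiveDegree {k : Type*} [Field k] {M : ℕ}
    (I : Ideal (MvPolynomial (Fin (M + 1)) k)) : ∃ z : ℤ, projectiveDegree I = z := by
  unfold projectiveDegree
  split_ifs with h
  · obtain ⟨n₀, hn⟩ := h.choose_spec
    set P := h.choose
    have h1 := congrFun P.fwdDiff_iter_degree_eq_factorial (n₀ : ℚ)
    rw [fwdDiff_iter_eq_sum_shift] at h1
    have h2 : ∀ k ∈ Finset.range (P.natDegree + 1),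
        ((-1 : ℤ) ^ (P.natDegree - k) * (P.natDegree.choose k : ℤ)) • P.eval ((n₀ : ℚ) + k • 1) =
        (((-1 : ℤ) ^ (P.natDegree - k) * (P.natDegree.choose k : ℤ) *
          hilbertFunction I (n₀ + k) : ℤ) : ℚ) := by
      intro k _
      have := hn (n₀ + k) (Nat.le_add_right _ _)
      push_cast at this
      rw [nsmul_one, this]
      simp
    rw [Finset.sum_congr rfl h2, ← Int.cast_sum] at h1
    refine ⟨_, Eq.trans ?_ h1.symm⟩
    simp [mul_comm]
  · exact ⟨0, by simp⟩

/-! ### Places not above infinity are integral on `A`. -/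

section Infinity

variable {Fq F K L : Type*} [Field Fq] [Fintype Fq] [Field F] [Algebra Fq F] [Field K]
    [Algebra Fq K] [Field L] [Algebra K L]

/-- The subring of `F` of the quotients `a / b` of elements of a subring with `w a ≤ w b`. -/
def quotientSubring {A Γ : Type*} [CommRing A] [LinearOrderedCommGroupWithZero Γ] (f : A →+* F)
    (hf : Function.Injective f) (w : Valuation A Γ) : Subring F where
  carrier := {y | ∃ a b : A, b ≠ 0 ∧ y = f a / f b ∧ w a ≤ w b}
  mul_mem' := by
    rintro _ _ ⟨a, b, hb, rfl, h⟩ ⟨c, d, hd, rfl, h'⟩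
    have : IsDomain A := hf.isDomain f
    exact ⟨a * c, b * d, mul_ne_zero hb hd, by simp [div_mul_div_comm],
      by rw [map_mul, map_mul]; exact mul_le_mul' h h'⟩
  one_mem' := ⟨1, 1, fun h => by simpa using congrArg f h, by simp, le_rfl⟩
  add_mem' := by
    rintro _ _ ⟨a, b, hb, rfl, h⟩ ⟨c, d, hd, rfl, h'⟩
    have : IsDomain A := hf.isDomain f
    have hb' : f b ≠ 0 := by simpa [map_eq_zero_iff f hf] using hb
    have hd' : f d ≠ 0 := by simpa [map_eq_zero_iff f hf] using hd
    refine ⟨a * d + b * c, b * d, mul_ne_zero hb hd, by rw [div_add_div _ _ hb' hd']; simp, ?_⟩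
    refine (w.map_add _ _).trans (max_le ?_ ?_)
    · rw [map_mul, map_mul]; exact mul_le_mul' h le_rfl
    · rw [map_mul, map_mul]; exact mul_le_mul' le_rfl h'
  zero_mem' := ⟨0, 1, fun h => by simpa using congrArg f h, by simp, by simp⟩
  neg_mem' := by
    rintro _ ⟨a, b, hb, rfl, h⟩
    exact ⟨-a, b, hb, by simp [neg_div], by rwa [Valuation.map_neg]⟩

/-- A valuation ring of `F` dominating the ring of quotients with `w a ≤ w b` is taken. Domination
gives both directions, and elements of `F` need not be known to be quotients of elements of `A`. -/
lemma exists_valuationSubring_extending {A Γ : Type*} [CommRing A]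
    [LinearOrderedCommGroupWithZero Γ] (f : A →+* F)
    (hf : Function.Injective f) (w : Valuation A Γ) (hw : ∀ a, a ≠ 0 → w a ≠ 0) :
    ∃ P : ValuationSubring F, ∀ a b : A, b ≠ 0 → (w a ≤ w b ↔ f a / f b ∈ P) := by
  have : IsDomain A := hf.isDomain f
  have hne : ∀ b, b ≠ 0 → f b ≠ 0 := fun b hb => by simpa [map_eq_zero_iff f hf] using hb
  let I : Ideal (quotientSubring f hf w) :=
    { carrier := {y | ∃ a b : A, b ≠ 0 ∧ (y : F) = f a / f b ∧ w a < w b}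
      add_mem' := by
        rintro x y ⟨a, b, hb, hx, h⟩ ⟨c, d, hd, hy, h'⟩
        refine ⟨a * d + b * c, b * d, mul_ne_zero hb hd, by
          rw [Subring.coe_add, hx, hy, div_add_div _ _ (hne _ hb) (hne _ hd)]; simp, ?_⟩
        refine (w.map_add _ _).trans_lt (max_lt ?_ ?_)
        · rw [map_mul, map_mul]
          exact mul_lt_mul_of_pos_right h (zero_lt_iff.2 (hw _ hd))
        · rw [map_mul, map_mul]
          exact mul_lt_mul_of_pos_left h' (zero_lt_iff.2 (hw _ hb))
      zero_mem' := ⟨0, 1, one_ne_zero, by simp, by simp⟩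
      smul_mem' := by
        rintro ⟨_, a, b, hb, rfl, h⟩ y ⟨c, d, hd, hy, h'⟩
        refine ⟨a * c, b * d, mul_ne_zero hb hd, by simp [hy, div_mul_div_comm], ?_⟩
        rw [map_mul, map_mul]
        exact (mul_le_mul_left h _).trans_lt (mul_lt_mul_of_pos_left h' (zero_lt_iff.2 (hw _ hb))) }
  have hI : I ≠ ⊤ := by
    rw [Ideal.ne_top_iff_one]
    rintro ⟨a, b, hb, h1, h⟩
    have : f a = f b := by
      rw [Subring.coe_one, eq_div_iff (hne b hb), one_mul] at h1
      exact h1.symm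
    rw [hf this] at h
    exact lt_irrefl _ h
  obtain ⟨P, hP, hP'⟩ := Ideal.image_subset_nonunits_valuationSubring I hI
  refine ⟨P, fun a b hb => ⟨fun h => hP ⟨a, b, hb, rfl, h⟩, fun hmem => ?_⟩⟩
  by_contra hlt
  rw [not_le] at hlt
  have ha : a ≠ 0 := by
    rintro rfl
    simp at hlt
  have hmem' : f b / f a ∈ P.nonunits :=
    hP' ⟨⟨f b / f a, b, a, ha, rfl, hlt.le⟩, ⟨b, a, ha, rfl, hlt⟩, rfl⟩
  rw [ValuationSubring.mem_nonunits_iff] at hmem'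
  rw [← ValuationSubring.valuation_le_one_iff] at hmem
  have := mul_lt_one_of_lt_of_le hmem' hmem
  rw [← map_mul, div_mul_div_cancel₀ (hne _ ha), div_self (hne _ hb), map_one] at this
  exact lt_irrefl _ this

/-- A pole of some `a ∈ A` at `v` gives a place `P` of `F` at which `a` is not regular. By the
definition of `A` this place is `inf`, so `v` would lie above infinity. -/
lemma val_le_one_of_not_liesAboveInfinity {inf : ValuationSubring F}
    {i : regularAway Fq inf →ₐ[Fq] K} (hi : Function.Injective i) {v : Valuation L ℤᵐ⁰}
    (hv : ¬ LiesAboveInfinity i v) (a : regularAway Fq inf) : v (algebraMap K L (i a)) ≤ 1 := by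
  by_contra hlt
  rw [not_le] at hlt
  apply hv
  let g : regularAway Fq inf →+* L := (algebraMap K L).comp i.toRingHom
  have hg : Function.Injective g := (algebraMap K L).injective.comp hi
  obtain ⟨P, hP⟩ := exists_valuationSubring_extending (F := F) (regularAway Fq inf).val.toRingHom
    Subtype.val_injective (v.comap g) fun a ha => by
      simpa [map_eq_zero_iff g hg] using ha
  have hP0 : ∀ a : regularAway Fq inf, v (g a) ≤ 1 ↔ (a : F) ∈ P := fun a => by
    simpa using hP a 1 one_ne_zero
  have hplace : IsPlace Fq P := by
    refine ⟨?_, fun c => ?_⟩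
    · rintro rfl
      exact absurd ((hP0 a).2 trivial) (not_le.2 hlt)
    · refine (hP0 (algebraMap Fq _ c)).1 ?_
      rcases eq_or_ne c 0 with rfl | hc
      · simp
      -- Nonzero constants are roots of unity, so they have value 1.
      have h1 : v (g (algebraMap Fq _ c)) ^ (Fintype.card Fq - 1) = 1 := by
        rw [← map_pow, ← map_pow, ← map_pow, FiniteField.pow_card_sub_one_eq_one c hc]
        simp
      have h2 : Fintype.card Fq - 1 ≠ 0 := by
        have := Fintype.one_lt_card (α := Fq)
        omega
      exact (pow_le_one_iff h2).1 h1.le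
  have hPinf : P = inf := by
    by_contra hne
    exact absurd ((hP0 a).2 (a.2 P hplace hne)) (not_le.2 hlt)
  intro a b hb
  exact (hP a b hb).trans (by rw [hPinf]; rfl)

end Infinity

/-! ### The index `r₀` does not depend on `t`. -/

namespace DrinfeldModule

variable {Fq A K : Type*} [Field Fq] [Fintype Fq] [CommRing A] [Algebra Fq A]
  [Field K] [Algebra Fq K] {i : A →ₐ[Fq] K} (φ : DrinfeldModule i)

/-- Compare the coefficients of `τ ^ s` in `PQ` and `QP`: only the constant term of `Q` contributes.
-/
lemma coeff_zero_pow_eq_of_commute {P Q : TwistedPoly Fq K} (hPQ : P * Q = Q * P) {s : ℕ}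
    (hPs : P.coeff s ≠ 0)
    (hQ : ∀ m, 1 ≤ m → m ≤ s → Q.coeff m = 0) :
    Q.coeff 0 ^ (Fintype.card Fq ^ s) = Q.coeff 0 := by
  have h1 : (P * Q).coeff s = P.coeff s * Q.coeff 0 ^ (Fintype.card Fq ^ s) := by
    rw [TwistedPoly.coeff_mul, Finset.sum_eq_single (s, 0)]
    · rintro ⟨a, b⟩ hab hne
      rw [Finset.HasAntidiagonal.mem_antidiagonal] at hab
      simp only at hab ⊢
      rcases Nat.eq_zero_or_pos b with rfl | hb
      · exact absurd (by rw [← hab, add_zero]) hne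
      · rw [hQ b hb (by omega), zero_pow (by positivity), mul_zero]
    · simp
  have h2 : (Q * P).coeff s = Q.coeff 0 * P.coeff s := by
    rw [TwistedPoly.coeff_mul, Finset.sum_eq_single (0, s)]
    · simp
    · rintro ⟨a, b⟩ hab hne
      rw [Finset.HasAntidiagonal.mem_antidiagonal] at hab
      simp only at hab ⊢
      rcases Nat.eq_zero_or_pos a with rfl | ha
      · exact absurd (by rw [← hab, zero_add]) hne
      · rw [hQ a ha (by omega), zero_mul]
    · simp
  rw [hPQ, h2, mul_comm] at h1
  exact (mul_left_cancel₀ hPs h1).symm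

lemma pow_card_ne_of_transcendental (hi : Function.Injective i) {t : A} (ht : Transcendental Fq t)
    {s : ℕ} (hs : 1 ≤ s) : i t ^ (Fintype.card Fq ^ s) ≠ i t := by
  intro h
  rw [← map_pow] at h
  have h' := hi h
  refine ht ⟨Polynomial.X ^ (Fintype.card Fq ^ s) - Polynomial.X, ?_, by simp [h']⟩
  exact FiniteField.X_pow_card_pow_sub_X_ne_zero Fq (by omega) Fintype.one_lt_card

/-- If `φ_t` had no term in degrees 1 to `n`, commuting with `φ_s` would give `t ^ (q ^ n) = t`, and
`t` would be algebraic. By symmetry the two least indices agree. -/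
lemma isLeast_of_isLeast (hi : Function.Injective i) {s t : A} (hs : Transcendental Fq s)
    (ht : Transcendental Fq t) {n : ℕ}
    (h : IsLeast {n : ℕ | 1 ≤ n ∧ (φ.toRingHom s).coeff n ≠ 0} n) :
    IsLeast {n : ℕ | 1 ≤ n ∧ (φ.toRingHom t).coeff n ≠ 0} n := by
  have core : ∀ {s t : A}, Transcendental Fq t → ∀ {n : ℕ},
      IsLeast {n : ℕ | 1 ≤ n ∧ (φ.toRingHom s).coeff n ≠ 0} n →
      ∃ m ≤ n, 1 ≤ m ∧ (φ.toRingHom t).coeff m ≠ 0 := by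
    intro s t ht n h
    by_contra! hcon
    have := coeff_zero_pow_eq_of_commute (P := φ.toRingHom s) (Q := φ.toRingHom t)
      (by rw [← map_mul, ← map_mul, mul_comm]) h.1.2 fun m h1 h2 => hcon m h2 h1
    rw [φ.coeff_zero] at this
    exact pow_card_ne_of_transcendental hi ht h.1.1 this
  obtain ⟨m, hmn, hm⟩ := core ht h
  classical
  have hex : ∃ m, 1 ≤ m ∧ (φ.toRingHom t).coeff m ≠ 0 := ⟨m, hm⟩
  have hl : IsLeast {n : ℕ | 1 ≤ n ∧ (φ.toRingHom t).coeff n ≠ 0} (Nat.find hex) :=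
    ⟨Nat.find_spec hex, fun k hk => Nat.find_min' hex hk⟩
  obtain ⟨k, hk, hk'⟩ := core hs hl
  have : Nat.find hex = n :=
    le_antisymm ((Nat.find_min' hex hm).trans hmn) ((h.2 hk').trans hk)
  rwa [this] at hl

end DrinfeldModule


/-! ### Finiteness of the zeros and poles of an element of `K`. -/

/-- A normalised valuation is determined by its valuation ring. -/
lemma eq_of_val_le_one_iff {L : Type*} [Field L] {v w : Valuation L ℤᵐ⁰}
    (hv : Function.Surjective v) (hw : Function.Surjective w) (h : ∀ y, v y ≤ 1 ↔ w y ≤ 1) :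
    v = w := by
  have heq : v.IsEquiv w := Valuation.isEquiv_of_val_le_one fun {y} => h y
  obtain ⟨π, hπ⟩ := hv (WithZero.exp (-1))
  have hπ0 : π ≠ 0 := by
    rintro rfl
    rw [map_zero] at hπ
    exact WithZero.exp_ne_zero hπ.symm
  have hzpow : ∀ y, y ≠ 0 → ordAt w y = ordAt v y * ordAt w π := by
    intro y hy
    have h1 : v y = v (π ^ (ordAt v y)) := by
      rw [map_zpow₀, hπ, val_eq_exp_neg_ordAt v hy, ← WithZero.exp_zsmul]
      simp
    have h2 : w y = w (π ^ (ordAt v y)) := heq.eq_iff.1 h1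
    rw [ordAt, h2, map_zpow₀, WithZero.log_zpow]
    simp [ordAt]
  have hone : ordAt w π = 1 := by
    obtain ⟨y, hy⟩ := hw (WithZero.exp (-1))
    have hy0 : y ≠ 0 := by
      rintro rfl
      rw [map_zero] at hy
      exact WithZero.exp_ne_zero hy.symm
    have h1 := hzpow y hy0
    have h2 : ordAt w y = 1 := by simp [ordAt, hy]
    rw [h2] at h1
    have h3 : 0 < ordAt w π := by
      rw [← val_lt_one_iff w hπ0, ← heq.lt_one_iff_lt_one, hπ, ← WithZero.exp_zero,
        WithZero.exp_lt_exp]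
      norm_num
    exact (Int.eq_one_or_neg_one_of_mul_eq_one' h1.symm).elim (·.2) fun h => by omega
  ext y
  rcases eq_or_ne y 0 with rfl | hy
  · simp
  · rw [val_eq_exp_neg_ordAt v hy, val_eq_exp_neg_ordAt w hy, hzpow y hy, hone, mul_one]

namespace NormalProjectiveModel

variable {k K : Type*} [Field k] [Field K] [Algebra k K] (V : NormalProjectiveModel k K)

lemma isFractionRing_chart {j : Fin (V.M + 1)} (hj : V.ξ j ≠ 0) :
    IsFractionRing (V.chart j) K := by
  refine IsFractionRing.of_field _ _ fun z => ?_
  have hz : z ∈ IntermediateField.adjoin k (Set.range fun l => V.ξ l / V.ξ j) := by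
    have : IntermediateField.adjoin k
        (Set.range fun p : Fin (V.M + 1) × Fin (V.M + 1) => V.ξ p.1 / V.ξ p.2) ≤
        IntermediateField.adjoin k (Set.range fun l => V.ξ l / V.ξ j) := by
      rw [IntermediateField.adjoin_le_iff]
      rintro _ ⟨⟨a, b⟩, rfl⟩
      have h := fun l => IntermediateField.subset_adjoin k (Set.range fun l => V.ξ l / V.ξ j)
        ⟨l, rfl⟩
      have := div_mem (h a) (h b)
      simp only [div_div_div_cancel_right₀ hj] at this
      exact this
    rw [V.functionField] at this
    exact this trivial
  obtain ⟨r, hr, s, hs, rfl⟩ := IntermediateField.mem_adjoin_iff_div.1 hz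
  exact ⟨⟨r, hr⟩, ⟨s, hs⟩, rfl⟩

lemma isNoetherianRing_chart (j : Fin (V.M + 1)) : IsNoetherianRing (V.chart j) := by
  have : Algebra.FiniteType k (V.chart j) := by
    rw [← Subalgebra.fg_iff_finiteType]
    exact ⟨(Set.finite_range _).toFinset, by rw [Set.Finite.coe_toFinset]; rfl⟩
  exact Algebra.FiniteType.isNoetherianRing k _

lemma isNoetherianRing_integralClosure_chart {j : Fin (V.M + 1)} (hj : V.ξ j ≠ 0) :
    IsNoetherianRing (integralClosure (V.chart j) K) := by
  have := V.isFractionRing_chart hj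
  have := V.isNoetherianRing_chart j
  have : IsIntegrallyClosed (V.chart j) := V.normal j hj
  refine isNoetherianRing_of_surjective (V.chart j) _ (algebraMap (V.chart j) _) ?_
  rintro ⟨y, hy⟩
  obtain ⟨x, hx⟩ := IsIntegrallyClosed.isIntegral_iff.1 hy
  exact ⟨x, Subtype.ext hx⟩

lemma exists_eq_div_chart {j : Fin (V.M + 1)} (hj : V.ξ j ≠ 0) {y : K} (hy : y ≠ 0) :
    ∃ b s : integralClosure (V.chart j) K, b ≠ 0 ∧ s ≠ 0 ∧ y = (b : K) / (s : K) := by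
  have := V.isFractionRing_chart hj
  obtain ⟨b, s, hs, h⟩ := IsFractionRing.div_surjective (A := V.chart j) y
  refine ⟨⟨algebraMap _ K b, isIntegral_algebraMap⟩, ⟨algebraMap _ K s, isIntegral_algebraMap⟩,
    fun hb => ?_, fun hs' => ?_, h.symm⟩
  · have hb' : algebraMap _ K b = 0 := congrArg Subtype.val hb
    rw [hb', zero_div] at h
    exact hy h.symm
  · have hb' : algebraMap _ K s = 0 := congrArg Subtype.val hs'
    rw [hb', div_zero] at h
    exact hy h.symm

/-- A prime of height one containing `b ≠ 0` is minimal over `(b)`, and a Noetherian ring has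
finitely many such primes. -/
lemma finite_height_one_primes {R : Type*} [CommRing R] [IsDomain R] [IsNoetherianRing R] {b : R}
    (hb : b ≠ 0) : {P : Ideal R | P.IsPrime ∧ P.height = 1 ∧ b ∈ P}.Finite := by
  refine (Ideal.finite_minimalPrimes_of_isNoetherianRing R (Ideal.span {b})).subset ?_
  rintro P ⟨hP, hh, hbP⟩
  refine Ideal.mem_minimalPrimes_of_height_le ((Ideal.span_singleton_le_iff_mem P).2 hbP) ?_
  rw [hh, Order.one_le_iff_ne_zero, Ne, Ideal.height_eq_zero_iff_eq_bot,
    Ideal.span_singleton_eq_bot]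
  exact hb

/-- The valuations whose ring is the localisation of `R` at a prime of height one. -/
def heightOneValuations (R K : Type*) [CommRing R] [Field K] [Algebra R K] :
    Set (Valuation K ℤᵐ⁰) :=
  {v | Function.Surjective v ∧ ∃ P : Ideal R, P.IsPrime ∧ P.height = 1 ∧
    ∀ y : K, v y ≤ 1 ↔ ∃ b s : R, s ∉ P ∧ y = algebraMap R K b / algebraMap R K s}

/-- Outside a prime that contains `b * s`, both `b` and `s` are units. Each prime carries at most
one normalised valuation, so finitely many primes give finitely many valuations. -/
lemma finite_heightOneValuations_ordAt_ne_zero {R K : Type*} [CommRing R] [IsDomain R]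
    [IsNoetherianRing R] [Field K] [Algebra R K] (hinj : Function.Injective (algebraMap R K))
    {b s : R} (hb : b ≠ 0) (hs : s ≠ 0) :
    {v | v ∈ heightOneValuations R K ∧ ordAt v (algebraMap R K b / algebraMap R K s) ≠ 0}.Finite := by
  let Φ : Ideal R → Set (Valuation K ℤᵐ⁰) := fun P => {v | Function.Surjective v ∧
    ∀ y : K, v y ≤ 1 ↔ ∃ b s : R, s ∉ P ∧ y = algebraMap R K b / algebraMap R K s}
  have hne : ∀ c : R, c ≠ 0 → algebraMap R K c ≠ 0 := fun c hc => by
    rwa [Ne, map_eq_zero_iff _ hinj]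
  refine ((finite_height_one_primes (mul_ne_zero hb hs)).biUnion (t := Φ)
    fun P _ => Set.Subsingleton.finite ?_).subset ?_
  · rintro v ⟨hv, hv'⟩ w ⟨hw, hw'⟩
    exact eq_of_val_le_one_iff hv hw fun y => (hv' y).trans (hw' y).symm
  · rintro v ⟨⟨hsurj, P, hP, hh, hv⟩, hne'⟩
    refine Set.mem_biUnion (x := P) ⟨hP, hh, ?_⟩ ⟨hsurj, hv⟩
    by_contra hmem
    have hval : ∀ c : R, c ∉ P → ordAt v (algebraMap R K c) = 0 := by
      intro c hc
      have hc0 : algebraMap R K c ≠ 0 := hne c fun h => hc (h ▸ P.zero_mem)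
      have h1 : v (algebraMap R K c) ≤ 1 := (hv _).2 ⟨c, 1, hP.one_notMem, by simp⟩
      have h2 : v (algebraMap R K c)⁻¹ ≤ 1 := (hv _).2 ⟨1, c, hc, by simp⟩
      rw [val_le_one_iff v hc0] at h1
      rw [val_le_one_iff v (inv_ne_zero hc0), ordAt_inv] at h2
      linarith
    apply hne'
    rw [ordAt_div v (hne b hb) (hne s hs), hval b fun h => hmem (P.mul_mem_right _ h),
      hval s fun h => hmem (P.mul_mem_left _ h), sub_zero]

/-- An element of `K` has order zero at almost all places of `K`. -/
lemma finite_places_ordAt_ne_zero {y : K} (hy : y ≠ 0) :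
    {v | v ∈ V.places K ∧ ordAt v y ≠ 0}.Finite := by
  have h : ∀ j, V.ξ j ≠ 0 → {v | v ∈ heightOneValuations (integralClosure (V.chart j) K) K ∧
      ordAt v y ≠ 0}.Finite := by
    intro j hj
    have := V.isNoetherianRing_integralClosure_chart hj
    obtain ⟨b, s, hb, hs, rfl⟩ := V.exists_eq_div_chart hj hy
    exact finite_heightOneValuations_ordAt_ne_zero Subtype.val_injective hb hs
  refine (Set.finite_iUnion fun j => Set.finite_iUnion fun hj : V.ξ j ≠ 0 => h j hj).subset ?_
  rintro v ⟨⟨hsurj, j, hj, P, hP, hh, hv⟩, hne⟩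
  exact Set.mem_iUnion.2 ⟨j, Set.mem_iUnion.2 ⟨hj, ⟨hsurj, P, hP, hh, hv⟩, hne⟩⟩

lemma exists_bound_ordAt (s : Finset K) :
    ∃ N : ℕ, 1 ≤ N ∧ ∀ v ∈ V.places K, ∀ y ∈ s, y ≠ 0 → |ordAt v y| ≤ N := by
  have h : ∀ y : K, ∃ N : ℕ, ∀ v ∈ V.places K, y ≠ 0 → |ordAt v y| ≤ N := by
    intro y
    rcases eq_or_ne y 0 with rfl | hy
    · exact ⟨0, fun v _ h => absurd rfl h⟩
    obtain ⟨N, hN⟩ := ((V.finite_places_ordAt_ne_zero hy).image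
      fun v => (ordAt v y).natAbs).bddAbove
    refine ⟨N, fun v hv _ => ?_⟩
    rw [Int.abs_eq_natAbs]
    by_cases h0 : ordAt v y = 0
    · simp [h0]
    · exact_mod_cast hN ⟨v, ⟨hv, h0⟩, rfl⟩
  choose N hN using h
  refine ⟨∑ y ∈ s, N y + 1, by omega, fun v hv y hy h0 => (hN y v hv h0).trans ?_⟩
  have := Finset.single_le_sum (f := N) (fun _ _ => Nat.zero_le _) hy
  exact_mod_cast this.trans (Nat.le_succ _)

end NormalProjectiveModel


/-! ### Pigeonhole arguments in ultrametric spaces. -/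

section Pigeonhole

/-- Either there is a large clique, or some element has many non-neighbours. -/
lemma exists_large_clique_or_fiber {X : Type*} [DecidableEq X] (r : X → X → Prop)
    (hr : ∀ x y, r x y → r y x) {A B : ℕ} :
    ∀ T : Finset X, A * B < T.card →
      (∃ T' ⊆ T, A < T'.card ∧ ∀ x ∈ T', ∀ y ∈ T', x ≠ y → r x y) ∨
      ∃ y ∈ T, ∃ T' ⊆ T, B < T'.card ∧ ∀ z ∈ T', z = y ∨ ¬ r z y := by
  classical
  induction A with
  | zero =>
    intro T hT
    obtain ⟨x, hx⟩ := Finset.card_pos.1 (lt_of_le_of_lt (Nat.zero_le _) hT)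
    exact Or.inl ⟨{x}, by simpa using hx, by simp, by simp⟩
  | succ A ih =>
    intro T hT
    obtain ⟨x, hx⟩ := Finset.card_pos.1 (lt_of_le_of_lt (Nat.zero_le _) hT)
    have hsplit := Finset.card_filter_add_card_filter_not (s := T) (fun z => z = x ∨ ¬ r z x)
    rcases lt_or_ge B (T.filter fun z => z = x ∨ ¬ r z x).card with h | h
    · exact Or.inr ⟨x, hx, _, Finset.filter_subset _ _, h, fun z hz => (Finset.mem_filter.1 hz).2⟩
    -- At most `B` elements are lost by keeping only the neighbours of `x`, so more than `A * B`
    -- remain; a clique among them is enlarged by `x`.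
    · rcases ih (T.filter fun z => ¬ (z = x ∨ ¬ r z x)) (by rw [add_mul, one_mul] at hT; omega) with
        ⟨T', hT', hcard, hcl⟩ | ⟨y, hy, T', hT', hcard, hf⟩
      · have hmem : ∀ z ∈ T', z ≠ x ∧ r z x := fun z hz => by
          have := (Finset.mem_filter.1 (hT' hz)).2
          push Not at this
          exact this
        refine Or.inl ⟨insert x T', ?_, ?_, ?_⟩
        · exact Finset.insert_subset hx (hT'.trans (Finset.filter_subset _ _))
        · rw [Finset.card_insert_of_notMem fun h => (hmem x h).1 rfl]
          omega
        · intro a ha b hb hab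
          rcases Finset.mem_insert.1 ha with rfl | ha' <;>
            rcases Finset.mem_insert.1 hb with rfl | hb'
          · exact absurd rfl hab
          · exact hr _ _ (hmem b hb').2
          · exact (hmem a ha').2
          · exact hcl a ha' b hb' hab
      · exact Or.inr ⟨y, Finset.filter_subset _ _ hy, T', hT'.trans (Finset.filter_subset _ _),
          hcard, hf⟩

variable {L : Type*} [Field L] (v : Valuation L ℤᵐ⁰)

lemma ordAt_sub_comm (x y : L) : ordAt v (x - y) = ordAt v (y - x) := by
  rw [← neg_sub, ordAt_neg]

/-- A large finite set with few distances contains a large equidistant subset. -/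
lemma exists_equidistant_subset {Q : ℕ} :
    ∀ (S : Finset ℤ) (T : Finset L), (∀ x ∈ T, ∀ y ∈ T, x ≠ y → ordAt v (x - y) ∈ S) →
      Q ^ S.card < T.card → 0 < Q →
      ∃ α : ℤ, ∃ T' ⊆ T, Q < T'.card ∧ ∀ x ∈ T', ∀ y ∈ T', x ≠ y → ordAt v (x - y) = α := by
  classical
  intro S
  induction hn : S.card generalizing S with
  | zero =>
    intro T hT hcard _
    rw [pow_zero] at hcard
    obtain ⟨x, hx, y, hy, hxy⟩ := Finset.one_lt_card.1 hcard
    rw [Finset.card_eq_zero] at hn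
    subst hn
    exact absurd (hT x hx y hy hxy) (by simp)
  | succ n ih =>
    intro T hT hcard hQ
    have hne : S.Nonempty := Finset.card_pos.1 (by omega)
    -- The least order is chosen because of the ultrametric inequality: points whose differences
    -- with `y` have order above `α` also have mutual differences of order above `α`, so `α` can be
    -- removed from `S`.
    set α := S.min' hne
    rw [pow_succ'] at hcard
    rcases exists_large_clique_or_fiber (fun x y => ordAt v (x - y) = α)
      (fun x y h => by rw [ordAt_sub_comm]; exact h) T hcard with
      ⟨T', hT', hc, h⟩ | ⟨y, hy, T', hT', hc, h⟩
    · exact ⟨α, T', hT', hc, h⟩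
    · obtain ⟨β, T'', hT'', h''⟩ := ih (S.erase α)
        (by rw [Finset.card_erase_of_mem (S.min'_mem hne), hn]; rfl) T' (by
          have hv : ∀ z ∈ T', v (z - y) < WithZero.exp (-α) := by
            intro z hz
            rcases eq_or_ne z y with rfl | hzy
            · rw [sub_self, map_zero]; exact WithZero.exp_pos
            · rw [val_lt_exp_iff v (sub_ne_zero.2 hzy)]
              exact lt_of_le_of_ne (S.min'_le _ (hT z (hT' hz) y hy hzy))
                (Ne.symm ((h z hz).resolve_left hzy))
          intro a ha b hb hab
          have hmem := hT a (hT' ha) b (hT' hb) hab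
          refine Finset.mem_erase.2 ⟨ne_of_gt ?_, hmem⟩
          rw [← val_lt_exp_iff v (sub_ne_zero.2 hab), ← sub_sub_sub_cancel_right a b y]
          exact (v.map_sub _ _).trans_lt (max_lt (hv a ha) (hv b hb))) hc hQ
      exact ⟨β, T'', hT''.trans hT', h''⟩

end Pigeonhole

/-! ### Counting roots in the residue field. -/

section RootCount

variable {L : Type*} [Field L] (v : Valuation L ℤᵐ⁰)

lemma residue_eq_zero_iff_val_lt_one (x : v.valuationSubring) :
    IsLocalRing.residue v.valuationSubring x = 0 ↔ v (x : L) < 1 := by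
  rw [IsLocalRing.residue_eq_zero_iff, IsLocalRing.mem_maximalIdeal, mem_nonunits_iff]
  have hx : v (x : L) ≤ 1 := x.2
  constructor
  · intro h
    refine lt_of_le_of_ne hx fun h1 => h ?_
    have hx0 : (x : L) ≠ 0 := fun h0 => by simp [h0] at h1
    exact IsUnit.of_mul_eq_one (⟨(x : L)⁻¹, by
      rw [Valuation.mem_valuationSubring_iff, map_inv₀, h1, inv_one]⟩ : v.valuationSubring)
      (Subtype.ext (mul_inv_cancel₀ hx0))
  · rintro h ⟨u, rfl⟩
    have h1 : v ((u : v.valuationSubring) : L) * v ((u⁻¹.1 : v.valuationSubring) : L) = 1 := by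
      rw [← map_mul, ← MulMemClass.coe_mul, Units.mul_inv]
      simp
    have h2 : v ((u⁻¹.1 : v.valuationSubring) : L) ≤ 1 := (u⁻¹.1 : v.valuationSubring).2
    exact absurd h1 (mul_lt_one_of_lt_of_le h h2).ne

/-- A polynomial with coefficients in a valuation ring, one of which is a unit, takes small values
on at most `deg` elements with distinct residues. -/
lemma card_le_natDegree_of_val_eval_lt_one {g : L[X]} (hg : ∀ n, v (g.coeff n) ≤ 1) {m : ℕ}
    (hm : v (g.coeff m) = 1) {T : Finset L} (hT : ∀ u ∈ T, v u ≤ 1)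
    (hsep : ∀ u ∈ T, ∀ u' ∈ T, u ≠ u' → v (u - u') = 1)
    (hroot : ∀ u ∈ T, v (g.eval u) < 1) : T.card ≤ g.natDegree := by
  classical
  obtain ⟨G, hG⟩ : ∃ G : v.valuationSubring[X], G.map v.valuationSubring.subtype = g := by
    have : g ∈ Polynomial.lifts v.valuationSubring.subtype := by
      rw [Polynomial.lifts_iff_coeff_lifts]
      exact fun n => ⟨⟨g.coeff n, hg n⟩, rfl⟩
    exact (Polynomial.mem_lifts _).1 this
  have hcoeff : ∀ n, ((G.coeff n : v.valuationSubring) : L) = g.coeff n := fun n => by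
    rw [← hG, Polynomial.coeff_map]
    rfl
  let res := IsLocalRing.residue v.valuationSubring
  have hne : G.map res ≠ 0 := by
    intro h
    have h1 : res (G.coeff m) = 0 := by rw [← Polynomial.coeff_map, h, Polynomial.coeff_zero]
    rw [residue_eq_zero_iff_val_lt_one, hcoeff, hm] at h1
    exact lt_irrefl _ h1
  let f : T → IsLocalRing.ResidueField v.valuationSubring := fun u => res ⟨u.1, hT u.1 u.2⟩
  have hf : Function.Injective f := by
    intro u u' h
    by_contra hne
    have h1 : res (⟨u.1, hT u.1 u.2⟩ - ⟨u'.1, hT u'.1 u'.2⟩) = 0 := by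
      rw [map_sub, sub_eq_zero]
      exact h
    rw [residue_eq_zero_iff_val_lt_one] at h1
    exact absurd (hsep u u.2 u' u'.2 fun h => hne (Subtype.ext h)) h1.ne
  have hsub : Finset.univ.image f ⊆ (G.map res).roots.toFinset := by
    intro a ha
    obtain ⟨u, -, rfl⟩ := Finset.mem_image.1 ha
    rw [Multiset.mem_toFinset, Polynomial.mem_roots hne, Polynomial.IsRoot.def,
      Polynomial.eval_map_apply, residue_eq_zero_iff_val_lt_one]
    have := hroot u.1 u.2
    rw [← hG] at this
    have h2 : (G.map v.valuationSubring.subtype).eval u.1 =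
        v.valuationSubring.subtype (G.eval ⟨u.1, hT u.1 u.2⟩) :=
      Polynomial.eval_map_apply (f := v.valuationSubring.subtype) (p := G) ⟨u.1, hT u.1 u.2⟩
    rw [h2] at this
    exact this
  calc T.card = (Finset.univ.image f).card := by
        rw [Finset.card_image_of_injective _ hf, Finset.card_univ, Fintype.card_coe]
    _ ≤ (G.map res).roots.toFinset.card := Finset.card_le_card hsub
    _ ≤ Multiset.card (G.map res).roots := Multiset.toFinset_card_le _
    _ ≤ (G.map res).natDegree := Polynomial.card_roots' _
    _ ≤ G.natDegree := Polynomial.natDegree_map_le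
    _ = g.natDegree := by
        rw [← hG, Polynomial.natDegree_map_eq_of_injective Subtype.val_injective]

end RootCount

/-! ### Differences whose iterates show no cancellation. -/

namespace TwistedPoly

variable {Fq K : Type*} [Field Fq] [Fintype Fq] [Field K] [Algebra Fq K]
  {L : Type*} [Field L] [Algebra K L] (v : Valuation L ℤᵐ⁰)

/-- The terms of `P.eval y` do not cancel: the value has the least order of the terms. -/
def NoCancel (P : TwistedPoly Fq K) (y : L) : Prop :=
  P.eval y ≠ 0 ∧ ∀ i, P.coeff i ≠ 0 → ordAt v (P.eval y) ≤ termOrd v P y i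

lemma exists_min_termOrd {P : TwistedPoly Fq K} (hP : P ≠ 0) (y : L) :
    ∃ j, P.coeff j ≠ 0 ∧ ∀ i, P.coeff i ≠ 0 → termOrd v P y j ≤ termOrd v P y i := by
  obtain ⟨j, hj, h⟩ := Finset.exists_min_image (SkewPolynomial.support P) (termOrd v P y)
    ⟨_, mem_support.2 (coeff_tauDegree_ne_zero hP)⟩
  exact ⟨j, mem_support.1 hj, fun i hi => h i (mem_support.2 hi)⟩

lemma noCancel_iff {P : TwistedPoly Fq K} {y : L} {j : ℕ} (hj : P.coeff j ≠ 0)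
    (h : ∀ i, P.coeff i ≠ 0 → termOrd v P y j ≤ termOrd v P y i) :
    NoCancel v P y ↔ ¬ v (P.eval y) < WithZero.exp (-termOrd v P y j) := by
  constructor
  · rintro ⟨h0, h1⟩
    rw [val_lt_exp_iff v h0, not_lt]
    exact h1 j hj
  · intro hlt
    have h0 : P.eval y ≠ 0 := fun h0 => hlt (by rw [h0, map_zero]; exact WithZero.exp_pos)
    rw [val_lt_exp_iff v h0, not_lt] at hlt
    exact ⟨h0, fun i hi => hlt.trans (h i hi)⟩

lemma NoCancel.ordAt_eq {P : TwistedPoly Fq K} {y : L} (hy : y ≠ 0) (hnc : NoCancel v P y) {j : ℕ}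
    (hj : P.coeff j ≠ 0) (h : ∀ i, P.coeff i ≠ 0 → termOrd v P y j ≤ termOrd v P y i) :
    ordAt v (P.eval y) = termOrd v P y j :=
  le_antisymm (hnc.2 j hj) ((val_le_exp_iff v hnc.1).1 (val_eval_le v hy h))

/-- After translating by `y₀` and scaling by one difference `w`, equidistant points acquire distinct
residues. Dividing `P(uw)` by a dominant term makes it integral with one coefficient equal to 1, and
cancellation means that its reduction vanishes at the residue of `u`. The reduction has degree at
most `q ^ deg P`. -/
lemma card_le_of_cancel {P : TwistedPoly Fq K} (hP : P ≠ 0) {T : Finset L} {α : ℤ}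
    (hsep : ∀ x ∈ T, ∀ y ∈ T, x ≠ y → ordAt v (x - y) = α) {y₀ : L} (hy₀ : y₀ ∈ T)
    (hcan : ∀ z ∈ T, z = y₀ ∨ ¬ NoCancel v P (z - y₀)) :
    T.card ≤ Fintype.card Fq ^ P.tauDegree := by
  classical
  by_cases h1 : ∃ z₁ ∈ T, z₁ ≠ y₀
  swap
  · push Not at h1
    calc T.card ≤ 1 := Finset.card_le_one.2 fun a ha b hb => (h1 a ha).trans (h1 b hb).symm
      _ ≤ _ := Nat.one_le_pow _ _ Fintype.card_pos
  obtain ⟨z₁, hz₁, hne₁⟩ := h1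
  set w := z₁ - y₀ with hw
  have hw0 : w ≠ 0 := sub_ne_zero.2 hne₁
  have hordw : ordAt v w = α := hsep _ hz₁ _ hy₀ hne₁
  obtain ⟨j, hj, hmin⟩ := exists_min_termOrd v hP w
  have hterm : ∀ y : L, ordAt v y = α → termOrd v P y = termOrd v P w := fun y hy => by
    funext i
    rw [termOrd, termOrd, hy, hordw]
  set c := algebraMap K L (P.coeff j) * w ^ (Fintype.card Fq ^ j) with hc
  have hc0 : c ≠ 0 := mul_ne_zero (by simpa using hj) (pow_ne_zero _ hw0)
  have hvc : v c = WithZero.exp (-termOrd v P w j) := val_term v hw0 hj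
  let coef : ℕ → L := fun i => algebraMap K L (P.coeff i) * w ^ (Fintype.card Fq ^ i) / c
  let g : L[X] := ∑ i ∈ Finset.range (P.tauDegree + 1),
    Polynomial.monomial (Fintype.card Fq ^ i) (coef i)
  have hcoef : ∀ i, v (coef i) ≤ 1 := by
    intro i
    by_cases hi : P.coeff i = 0
    · simp [coef, hi]
    · rw [map_div₀, val_term v hw0 hi, hvc, div_le_one₀ WithZero.exp_pos, WithZero.exp_le_exp]
      exact neg_le_neg (hmin i hi)
  have hq : 2 ≤ Fintype.card Fq := Fintype.one_lt_card
  have hgj : g.coeff (Fintype.card Fq ^ j) = 1 := by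
    simp only [g, Polynomial.finsetSum_coeff, Polynomial.coeff_monomial]
    rw [Finset.sum_eq_single j]
    · rw [if_pos rfl]
      exact div_self hc0
    · intro i _ hij
      rw [if_neg fun h => hij (Nat.pow_right_injective hq h)]
    · intro h
      exact absurd (Finset.mem_range.2 (Nat.lt_succ_of_le (le_tauDegree hj))) h
  have heval : ∀ u, g.eval u = P.eval (u * w) / c := by
    intro u
    rw [eval_eq_sum_range (Nat.lt_succ_self _), Finset.sum_div]
    simp only [g, Polynomial.eval_finsetSum, Polynomial.eval_monomial, coef]
    refine Finset.sum_congr rfl fun i _ => ?_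
    rw [mul_pow]
    ring
  let f : L → L := fun z => (z - y₀) / w
  have hf : Function.Injective f := fun a b h => by
    simpa [f, div_left_inj' hw0] using h
  have hval1 : ∀ z ∈ T, ∀ z' ∈ T, z ≠ z' → v ((z - z') / w) = 1 := by
    intro z hz z' hz' hne
    rw [map_div₀, val_eq_exp_neg_ordAt v (sub_ne_zero.2 hne), hsep z hz z' hz' hne,
      val_eq_exp_neg_ordAt v hw0, hordw, div_self WithZero.exp_ne_zero]
  have := card_le_natDegree_of_val_eval_lt_one v (g := g) (m := Fintype.card Fq ^ j)
    (T := T.image f) (fun n => by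
      simp only [g, Polynomial.finsetSum_coeff, Polynomial.coeff_monomial]
      refine v.map_sum_le fun i _ => ?_
      split_ifs
      · exact hcoef i
      · simp) (by rw [hgj, map_one]) (by
      intro u hu
      obtain ⟨z, hz, rfl⟩ := Finset.mem_image.1 hu
      rcases eq_or_ne z y₀ with rfl | hne
      · simp [f]
      · exact (hval1 z hz y₀ hy₀ hne).le) (by
      intro u hu u' hu' hne
      obtain ⟨z, hz, rfl⟩ := Finset.mem_image.1 hu
      obtain ⟨z', hz', rfl⟩ := Finset.mem_image.1 hu'
      have := hval1 z hz z' hz' fun h => hne (by rw [h])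
      simp only [f]
      rwa [← sub_div, sub_sub_sub_cancel_right]) (by
      intro u hu
      obtain ⟨z, hz, rfl⟩ := Finset.mem_image.1 hu
      simp only [heval, f]
      rw [div_mul_cancel₀ _ hw0, map_div₀, hvc, div_lt_one₀ WithZero.exp_pos]
      rcases hcan z hz with rfl | hnc
      · rw [sub_self, eval_map_zero, map_zero]
        exact WithZero.exp_pos
      · rcases eq_or_ne z y₀ with rfl | hne
        · rw [sub_self, eval_map_zero, map_zero]
          exact WithZero.exp_pos
        have ht := hterm (z - y₀) (hsep z hz y₀ hy₀ hne)
        rw [noCancel_iff v hj (by rwa [ht]), not_not, ht] at hnc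
        exact hnc)
  rw [Finset.card_image_of_injective _ hf] at this
  refine this.trans (Polynomial.natDegree_sum_le_of_forall_le _ _ fun i hi => ?_)
  refine (Polynomial.natDegree_monomial_le _).trans ?_
  exact Nat.pow_le_pow_right (by omega) (Nat.lt_succ_iff.1 (Finset.mem_range.1 hi))

/-- In a large equidistant set, some difference can be iterated without cancellation. -/
lemma exists_sub_noCancel {P : TwistedPoly Fq K} (hP : P ≠ 0) (n : ℕ) :
    ∀ (T : Finset L) (α : ℤ), (∀ x ∈ T, ∀ y ∈ T, x ≠ y → ordAt v (x - y) = α) →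
      (Fintype.card Fq ^ P.tauDegree) ^ n < T.card →
      ∃ x ∈ T, ∃ y ∈ T, x ≠ y ∧ ∀ k < n, NoCancel v P (P.eval^[k] (x - y)) := by
  classical
  induction n with
  | zero =>
    intro T α _ hcard
    rw [pow_zero] at hcard
    obtain ⟨x, hx, y, hy, hxy⟩ := Finset.one_lt_card.1 hcard
    exact ⟨x, hx, y, hy, hxy, by simp⟩
  | succ n ih =>
    intro T α hsep hcard
    have heval_neg : ∀ z : L, P.eval (-z) = - P.eval z := fun z => by
      have := P.eval_map_sub 0 z
      rwa [zero_sub, eval_map_zero, zero_sub] at this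
    rw [pow_succ] at hcard
    -- Join two points when their difference shows no cancellation. On a clique `P` is injective and
    -- the image is again equidistant, since the order of `P(x - y)` is then determined by that of
    -- `x - y`; so the induction continues with the image.
    rcases exists_large_clique_or_fiber (fun x y => NoCancel v P (x - y))
      (fun x y h => by
        simp only [NoCancel, termOrd] at h ⊢
        rw [← neg_sub x y, heval_neg, ordAt_neg, ordAt_neg]
        exact ⟨neg_ne_zero.2 h.1, h.2⟩) T hcard with
      ⟨T', hT', hc, h⟩ | ⟨y, hy, T', hT', hc, h⟩
    · have hinj : Set.InjOn (P.eval (L := L)) T' := by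
        intro x hx y hy hxy
        by_contra hne
        apply (h x hx y hy hne).1
        rw [eval_map_sub, hxy, sub_self]
      obtain ⟨x₀, hx₀, y₀, hy₀, hne₀⟩ := Finset.one_lt_card.1
        (lt_of_le_of_lt (Nat.one_le_pow n _ (Nat.pow_pos Fintype.card_pos)) hc)
      obtain ⟨j, hj, hmin⟩ := exists_min_termOrd v hP (x₀ - y₀)
      obtain ⟨_, hx, _, hy, hxy, hk⟩ := ih (T'.image P.eval) (termOrd v P (x₀ - y₀) j) (by
        intro a ha b hb hab
        obtain ⟨x, hx, rfl⟩ := Finset.mem_image.1 ha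
        obtain ⟨y, hy, rfl⟩ := Finset.mem_image.1 hb
        have hne : x ≠ y := fun h => hab (by rw [h])
        have ht : termOrd v P (x - y) = termOrd v P (x₀ - y₀) := by
          funext i
          rw [termOrd, termOrd, hsep x (hT' hx) y (hT' hy) hne,
            hsep x₀ (hT' hx₀) y₀ (hT' hy₀) hne₀]
        rw [← eval_map_sub, NoCancel.ordAt_eq v (sub_ne_zero.2 hne) (h x hx y hy hne) hj
          (by rwa [ht]), ht]) (by rwa [Finset.card_image_of_injOn hinj])
      obtain ⟨x, hxT, rfl⟩ := Finset.mem_image.1 hx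
      obtain ⟨y, hyT, rfl⟩ := Finset.mem_image.1 hy
      have hne : x ≠ y := fun h => hxy (by rw [h])
      refine ⟨x, hT' hxT, y, hT' hyT, hne, fun k hkn => ?_⟩
      cases k with
      | zero => exact h x hxT y hyT hne
      | succ k =>
        rw [Function.iterate_succ_apply, eval_map_sub]
        exact hk k (by omega)
    -- The other alternative gives more than `q ^ deg P` points cancelling against `y`, contrary to
    -- the root count.
    · exfalso
      have hsep' : ∀ a ∈ insert y T', ∀ b ∈ insert y T', a ≠ b → ordAt v (a - b) = α := by
        intro a ha b hb hab
        exact hsep a (Finset.insert_subset hy hT' ha) b (Finset.insert_subset hy hT' hb) hab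
      have := card_le_of_cancel v hP hsep' (Finset.mem_insert_self y T') (by
        intro z hz
        rcases Finset.mem_insert.1 hz with rfl | hz
        · exact Or.inl rfl
        · exact h z hz)
      have h2 := Finset.card_le_card (Finset.subset_insert y T')
      omega

end TwistedPoly

/-! ### Dynamics at a tamely ramified place. -/

/-- A common denominator, prime to `q`, of the slopes of a twisted polynomial of degree `r`. -/
def slopeDenom (q r : ℕ) : ℕ := ∏ k ∈ Finset.Icc 1 r, (q ^ k - 1)

lemma slopeDenom_pos {q : ℕ} (hq : 2 ≤ q) (r : ℕ) : 0 < slopeDenom q r := by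
  refine Finset.prod_pos fun k hk => ?_
  have := Nat.one_lt_pow (Nat.one_le_iff_ne_zero.1 (Finset.mem_Icc.1 hk).1) hq
  omega

lemma dvd_slopeDenom {q k r : ℕ} (hq : 2 ≤ q) (hk : 1 ≤ k) (hkr : k ≤ r) :
    (q : ℤ) ^ k - 1 ∣ (slopeDenom q r : ℤ) := by
  have h : q ^ k - 1 ∣ slopeDenom q r := Finset.dvd_prod_of_mem _ (Finset.mem_Icc.2 ⟨hk, hkr⟩)
  have h1 : 1 ≤ q ^ k := Nat.one_le_pow _ _ (by omega)
  have h2 := Int.natCast_dvd_natCast.2 h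
  rw [Nat.cast_sub h1] at h2
  exact_mod_cast h2

namespace TwistedPoly

variable {Fq K : Type*} [Field Fq] [Fintype Fq] [Field K] [Algebra Fq K]
  {L : Type*} [Field L] [Algebra K L]

/-- The situation at a tamely ramified place: `e` is the ramification index, `α i` is the order of
the `i`-th coefficient of `P` below, and `R / slopeDenom` is the order of the points on the boundary
of the largest disc around the origin stable under `P`. -/
structure TameSetup (P : TwistedPoly Fq K) (v : Valuation L ℤᵐ⁰) (e : ℕ) (α : ℕ → ℤ) (N r₀ : ℕ)
    (R : ℤ) : Prop where
  e_pos : 0 < e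
  coprime : IsCoprime (e : ℤ) (Fintype.card Fq : ℤ)
  ord_coeff : ∀ i, P.coeff i ≠ 0 → ordAt v (algebraMap K L (P.coeff i)) = e * α i
  abs_le : ∀ i, P.coeff i ≠ 0 → |α i| ≤ N
  nonneg : P.coeff 0 ≠ 0 → 0 ≤ α 0
  radius_le : ∀ i, 1 ≤ i → P.coeff i ≠ 0 →
    0 ≤ α i * slopeDenom (Fintype.card Fq) P.tauDegree + ((Fintype.card Fq : ℤ) ^ i - 1) * R
  radius_eq : ∃ j, r₀ ≤ j ∧ P.coeff j ≠ 0 ∧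
    α j * slopeDenom (Fintype.card Fq) P.tauDegree + ((Fintype.card Fq : ℤ) ^ j - 1) * R = 0
  abs_radius : |R| ≤ N * slopeDenom (Fintype.card Fq) P.tauDegree

/-- `R / D` is the maximum of `-α i / (q ^ i - 1)` over `i ≥ 1`: the condition that every
nonconstant term maps the disc into itself, with equality for some `j`. -/
lemma exists_radius {P : TwistedPoly Fq K} {α : ℕ → ℤ} {N r₀ : ℕ}
    (hN : ∀ i, P.coeff i ≠ 0 → |α i| ≤ N) (hr₀ : 1 ≤ r₀) (hP : P.coeff r₀ ≠ 0)
    (hmin : ∀ i, 1 ≤ i → P.coeff i ≠ 0 → r₀ ≤ i) :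
    ∃ R : ℤ, (∀ i, 1 ≤ i → P.coeff i ≠ 0 →
      0 ≤ α i * slopeDenom (Fintype.card Fq) P.tauDegree + ((Fintype.card Fq : ℤ) ^ i - 1) * R) ∧
    (∃ j, r₀ ≤ j ∧ P.coeff j ≠ 0 ∧
      α j * slopeDenom (Fintype.card Fq) P.tauDegree + ((Fintype.card Fq : ℤ) ^ j - 1) * R = 0) ∧
    |R| ≤ N * slopeDenom (Fintype.card Fq) P.tauDegree := by
  have hq : 2 ≤ Fintype.card Fq := Fintype.one_lt_card
  set q := Fintype.card Fq
  have hDpos : (0 : ℤ) < slopeDenom q P.tauDegree := by exact_mod_cast slopeDenom_pos hq _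
  set D : ℤ := (slopeDenom q P.tauDegree : ℤ)
  have hex : ∀ i : ℕ, ∃ d : ℤ, 1 ≤ i → P.coeff i ≠ 0 → D = ((q : ℤ) ^ i - 1) * d := by
    intro i
    by_cases h : 1 ≤ i ∧ P.coeff i ≠ 0
    · obtain ⟨d, hd⟩ := dvd_slopeDenom hq h.1 (le_tauDegree h.2)
      exact ⟨d, fun _ _ => hd⟩
    · exact ⟨0, fun h1 h2 => absurd ⟨h1, h2⟩ h⟩
  choose d hd using hex
  obtain ⟨j, hj, hjmax⟩ := Finset.exists_max_image
    ((SkewPolynomial.support P).filter (1 ≤ ·)) (fun i => -α i * d i)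
    ⟨r₀, Finset.mem_filter.2 ⟨mem_support.2 hP, hr₀⟩⟩
  rw [Finset.mem_filter, mem_support] at hj
  have hqi : ∀ i, 1 ≤ i → (1 : ℤ) ≤ (q : ℤ) ^ i - 1 := fun i hi => by
    have : (2 : ℤ) ^ 1 ≤ (q : ℤ) ^ i :=
      (pow_le_pow_right₀ (by norm_num) hi).trans (pow_le_pow_left₀ (by norm_num) (by exact_mod_cast hq) i)
    linarith
  refine ⟨-α j * d j, fun i hi hPi => ?_, ⟨j, hmin j hj.2 hj.1, hj.1, ?_⟩, ?_⟩
  · have h1 := hjmax i (Finset.mem_filter.2 ⟨mem_support.2 hPi, hi⟩)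
    have h2 := hqi i hi
    rw [hd i hi hPi]
    nlinarith
  · rw [hd j hj.2 hj.1]
    ring
  · have h1 := hd j hj.2 hj.1
    have h2 := hqi j hj.2
    have h3 : 0 < d j := by
      by_contra h
      nlinarith
    have h4 : d j ≤ D := by nlinarith
    rw [abs_mul, abs_neg, abs_of_pos h3]
    exact mul_le_mul (hN j hj.1) h4 h3.le (Nat.cast_nonneg _)

variable {P : TwistedPoly Fq K} {v : Valuation L ℤᵐ⁰} {e : ℕ} {α : ℕ → ℤ} {N r₀ : ℕ} {R : ℤ}

/-- The (scaled) distance of `y` from the largest stable disc around the origin. -/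
def depth (P : TwistedPoly Fq K) (v : Valuation L ℤᵐ⁰) (e : ℕ) (R : ℤ) (y : L) : ℤ :=
  e * R - slopeDenom (Fintype.card Fq) P.tauDegree * ordAt v y

variable (P) in
lemma slopeDenom_card_pos : (0 : ℤ) < slopeDenom (Fintype.card Fq) P.tauDegree := by
  exact_mod_cast slopeDenom_pos Fintype.one_lt_card _

lemma TameSetup.coeffBound (S : TameSetup P v e α N r₀ R) : CoeffBound L v P (N * e) := by
  intro i hi
  rw [S.ord_coeff i hi, abs_mul, Nat.abs_cast, mul_comm]
  exact mul_le_mul_of_nonneg_right (S.abs_le i hi) (Nat.cast_nonneg _)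

/-- The 3 in `3NDe` is 1 for the radius, `|R| ≤ ND`, plus 2 for the threshold `-2B` with `B = Ne`.
-/
lemma TameSetup.ordAt_lt_of_depth (S : TameSetup P v e α N r₀ R) {y : L}
    (hy : 3 * N * slopeDenom (Fintype.card Fq) P.tauDegree * e < depth P v e R y) :
    ordAt v y < -2 * (N * e) := by
  have hD := slopeDenom_card_pos P
  have hR := (_root_.abs_le.1 S.abs_radius).2
  unfold depth at hy
  set D : ℤ := (slopeDenom (Fintype.card Fq) P.tauDegree : ℤ)
  have he : (0 : ℤ) < e := by exact_mod_cast S.e_pos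
  have h1 : (e : ℤ) * R ≤ e * (N * D) := mul_le_mul_of_nonneg_left hR he.le
  have h2 : D * ordAt v y < D * (-2 * (N * e)) := by linarith
  exact lt_of_mul_lt_mul_left h2 hD.le

/-- The disc is stable: the term of index 0 preserves it because its coefficient is integral, the
others by the choice of `R`. -/
lemma TameSetup.depth_eval_nonpos (S : TameSetup P v e α N r₀ R) {y : L} (hy : y ≠ 0)
    (hd : depth P v e R y ≤ 0) (hy' : P.eval y ≠ 0) : depth P v e R (P.eval y) ≤ 0 := by
  have hD := slopeDenom_card_pos P
  have he : (0 : ℤ) < e := by exact_mod_cast S.e_pos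
  obtain ⟨j, hj, hmin⟩ := exists_min_termOrd v (P := P) (by
    rintro rfl
    exact hy' rfl) y
  have h1 := (val_le_exp_iff v hy').1 (val_eval_le v hy hmin)
  have h2 : (e : ℤ) * R ≤ slopeDenom (Fintype.card Fq) P.tauDegree * termOrd v P y j := by
    have hα : j = 0 ∨ 1 ≤ j := by omega
    unfold depth at hd
    rw [termOrd, S.ord_coeff j hj]
    rcases hα with rfl | hj1
    · have := S.nonneg hj
      have := mul_nonneg (mul_nonneg hD.le he.le) this
      rw [pow_zero, one_mul]
      nlinarith
    · have h3 := mul_nonneg he.le (S.radius_le j hj1 hj)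
      have h4 := one_le_card_pow Fq j
      nlinarith
  unfold depth
  nlinarith

/-- Without cancellation the order of `P(y)` is at most that of the term `j` attaining the radius,
which multiplies the depth by exactly `q ^ j`, and `j ≥ r₀`. -/
lemma TameSetup.depth_eval_of_noCancel (S : TameSetup P v e α N r₀ R) {y : L}
    (hnc : NoCancel v P y) (hd : 0 < depth P v e R y) :
    (Fintype.card Fq : ℤ) ^ r₀ * depth P v e R y ≤ depth P v e R (P.eval y) := by
  have hD := slopeDenom_card_pos P
  obtain ⟨j, hrj, hj, hR⟩ := S.radius_eq
  have h1 := mul_le_mul_of_nonneg_left (hnc.2 j hj) hD.le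
  rw [termOrd, S.ord_coeff j hj] at h1
  have h2 : (Fintype.card Fq : ℤ) ^ r₀ ≤ (Fintype.card Fq : ℤ) ^ j :=
    pow_le_pow_right₀ (by linarith [two_le_card Fq]) hrj
  have h3 := mul_le_mul_of_nonneg_right h2 hd.le
  refine h3.trans ?_
  unfold depth at *
  have h4 := congrArg (fun z => (e : ℤ) * z) hR
  simp only [mul_zero] at h4
  nlinarith

lemma TameSetup.depth_iterate (S : TameSetup P v e α N r₀ R) {y : L} {n : ℕ}
    (hnc : ∀ k < n, NoCancel v P (P.eval^[k] y)) (hd : 0 < depth P v e R y) :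
    (Fintype.card Fq : ℤ) ^ (r₀ * n) * depth P v e R y ≤ depth P v e R (P.eval^[n] y) := by
  induction n with
  | zero => simp
  | succ n ih =>
    have h1 := ih fun k hk => hnc k (by omega)
    have h0 := one_le_card_pow Fq (r₀ * n)
    have h2 := S.depth_eval_of_noCancel (hnc n (by omega)) (by nlinarith)
    rw [Function.iterate_succ_apply', mul_add, mul_one, pow_add]
    have h3 := mul_le_mul_of_nonneg_left h1 (zero_le_one.trans (one_le_card_pow Fq r₀))
    linarith

/-- This is where tameness enters. If the terms `i < i'` had equal order, `e` would divide `q ^ i (q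
^ (i' - i) - 1) ord y`, hence `D · ord y` as `e` is prime to `q`. So the least term is unique;
modulo `e` its order is `q ^ j ord y`, so indivisibility persists. -/
lemma TameSetup.noCancel_of_not_dvd (S : TameSetup P v e α N r₀ R) {y : L}
    (hdvd : ¬ (e : ℤ) ∣ slopeDenom (Fintype.card Fq) P.tauDegree * ordAt v y) :
    NoCancel v P y ∧
      ¬ (e : ℤ) ∣ slopeDenom (Fintype.card Fq) P.tauDegree * ordAt v (P.eval y) := by
  have hy : y ≠ 0 := by
    rintro rfl
    simp [ordAt_zero] at hdvd
  have hP : P ≠ 0 := by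
    rintro rfl
    obtain ⟨j, -, hj, -⟩ := S.radius_eq
    exact hj rfl
  obtain ⟨j, hj, hmin⟩ := exists_min_termOrd v hP y
  have hlt : ∀ i i', i < i' → P.coeff i ≠ 0 → P.coeff i' ≠ 0 →
      termOrd v P y i ≠ termOrd v P y i' := by
    intro i i' hii' hi hi' h
    apply hdvd
    rw [termOrd, termOrd, S.ord_coeff i hi, S.ord_coeff i' hi'] at h
    have h1 : (e : ℤ) ∣ (Fintype.card Fq : ℤ) ^ i *
        (((Fintype.card Fq : ℤ) ^ (i' - i) - 1) * ordAt v y) := by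
      refine ⟨α i - α i', ?_⟩
      have h2 : (Fintype.card Fq : ℤ) ^ i' =
          (Fintype.card Fq : ℤ) ^ i * (Fintype.card Fq : ℤ) ^ (i' - i) := by
        rw [← pow_add, Nat.add_sub_cancel' hii'.le]
      rw [h2] at h
      linarith
    have h3 := (S.coprime.pow_right (n := i)).dvd_of_dvd_mul_left h1
    exact h3.trans (mul_dvd_mul_right (dvd_slopeDenom Fintype.one_lt_card (by omega)
      ((Nat.sub_le _ _).trans (le_tauDegree hi'))) _)
  have hne : ∀ i, P.coeff i ≠ 0 → i ≠ j → termOrd v P y j < termOrd v P y i := by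
    intro i hi hij
    refine lt_of_le_of_ne (hmin i hi) ?_
    rcases lt_or_gt_of_ne hij with h | h
    · exact (hlt i j h hi hj).symm
    · exact hlt j i h hj hi
  obtain ⟨h0, h1⟩ := ordAt_eval_of_unique_min v hy hj hne
  refine ⟨⟨h0, fun i hi => h1.trans_le (hmin i hi)⟩, fun h => hdvd ?_⟩
  rw [h1, termOrd, S.ord_coeff j hj, mul_add] at h
  have h2 := (dvd_add_right ((dvd_mul_right (e : ℤ) (α j)).mul_left _)).1 h
  rw [mul_left_comm] at h2
  exact (S.coprime.pow_right (n := j)).dvd_of_dvd_mul_left h2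

lemma TameSetup.noCancel_iterate (S : TameSetup P v e α N r₀ R) {y : L}
    (hdvd : ¬ (e : ℤ) ∣ slopeDenom (Fintype.card Fq) P.tauDegree * ordAt v y) (n : ℕ) :
    NoCancel v P (P.eval^[n] y) ∧
      ¬ (e : ℤ) ∣ slopeDenom (Fintype.card Fq) P.tauDegree * ordAt v (P.eval^[n] y) := by
  induction n with
  | zero => exact S.noCancel_of_not_dvd hdvd |>.imp_right fun _ => hdvd
  | succ n ih =>
    rw [Function.iterate_succ_apply']
    have h := (S.noCancel_of_not_dvd ih.2).2
    exact ⟨(S.noCancel_of_not_dvd h).1, h⟩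

/-- The possible orders, divisible by `e / slopeDenom`, in the annulus where cancellation may
occur. -/
def annulusOrders (e N D : ℕ) : Finset ℤ :=
  (Finset.Ico (-2 * (N * D) : ℤ) (N * D)).image fun k => e * k / D

lemma card_annulusOrders_le (e N D : ℕ) : (annulusOrders e N D).card ≤ 3 * N * D := by
  refine Finset.card_image_le.trans ?_
  rw [Int.card_Ico]
  have : ((N : ℤ) * D - -2 * (N * D)) = ((3 * N * D : ℕ) : ℤ) := by push_cast; ring
  rw [this, Int.toNat_natCast]

lemma TameSetup.ordAt_mem_annulusOrders (S : TameSetup P v e α N r₀ R) {y : L}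
    (hd : 0 < depth P v e R y) (hlow : ¬ ordAt v y < -2 * (N * e))
    (hdvd : (e : ℤ) ∣ slopeDenom (Fintype.card Fq) P.tauDegree * ordAt v y) :
    ordAt v y ∈ annulusOrders e N (slopeDenom (Fintype.card Fq) P.tauDegree) := by
  have hD := slopeDenom_card_pos P
  have he : (0 : ℤ) < e := by exact_mod_cast S.e_pos
  have hR := (_root_.abs_le.1 S.abs_radius).2
  obtain ⟨k, hk⟩ := hdvd
  unfold depth at hd
  refine Finset.mem_image.2 ⟨k, Finset.mem_Ico.2 ⟨?_, ?_⟩, ?_⟩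
  · rw [not_lt] at hlow
    have h1 := mul_le_mul_of_nonneg_left hlow hD.le
    rw [hk] at h1
    exact le_of_mul_le_mul_left (by linarith) he
  · rw [hk, ← mul_sub] at hd
    have := pos_of_mul_pos_right hd he.le
    linarith
  · rw [← hk]
    exact Int.mul_ediv_cancel_left _ hD.ne'

lemma le_depth_of_dvd {L : Type*} [Field L] {v : Valuation L ℤᵐ⁰} {y : L}
    (hd : 0 < depth P v e R y)
    (hdvd : (e : ℤ) ∣ slopeDenom (Fintype.card Fq) P.tauDegree * ordAt v y) :
    (e : ℤ) ≤ depth P v e R y :=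
  Int.le_of_dvd hd (dvd_sub (dvd_mul_right _ _) hdvd)

end TwistedPoly

/-! ### The lower bound for the local limit. -/

namespace DrinfeldModule

variable {Fq A K : Type*} [Field Fq] [Fintype Fq] [CommRing A] [Algebra Fq A]
  [Field K] [Algebra Fq K] {i : A →ₐ[Fq] K} (φ : DrinfeldModule i)
  {L : Type*} [Field L] [Algebra K L]

lemma eval_pow_eq_iterate (t : A) (y : L) (n : ℕ) :
    (φ.toRingHom (t ^ n)).eval y = (φ.toRingHom t).eval^[n] y := by
  induction n with
  | zero => simp [TwistedPoly.eval_one]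
  | succ n ih => rw [eval_pow_succ, ih, Function.iterate_succ_apply']

lemma tauDegree_algebraMap (c : Fq) : (φ.toRingHom (algebraMap Fq A c)).tauDegree = 0 := by
  rcases eq_or_ne c 0 with rfl | hc
  · rw [map_zero, map_zero]
    exact Nat.le_zero.1 (TwistedPoly.tauDegree_le fun _ _ => rfl)
  have h1 : φ.toRingHom (algebraMap Fq A c) ^ (Fintype.card Fq - 1) = 1 := by
    rw [← map_pow, ← map_pow, FiniteField.pow_card_sub_one_eq_one c hc, map_one, map_one]
  have h2 : Fintype.card Fq - 1 ≠ 0 := by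
    have := Fintype.one_lt_card (α := Fq)
    omega
  have h3 : φ.toRingHom (algebraMap Fq A c) ≠ 0 := by
    intro h0
    rw [h0, zero_pow h2] at h1
    exact TwistedPoly.one_ne_zero' h1.symm
  have h4 := TwistedPoly.tauDegree_pow h3 (Fintype.card Fq - 1)
  rw [h1, TwistedPoly.tauDegree_one] at h4
  exact (Nat.mul_eq_zero.1 h4.symm).resolve_left h2

/-- The element of `Fq[t]` with coefficients `g`. -/
def polyIn {Fq A : Type*} [Field Fq] [CommRing A] [Algebra Fq A] (t : A) {m : ℕ}
    (g : Fin m → Fq) : A := ∑ j, algebraMap Fq A (g j) * t ^ (j : ℕ)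

lemma polyIn_sub {Fq A : Type*} [Field Fq] [CommRing A] [Algebra Fq A] (t : A) {m : ℕ}
    (g g' : Fin m → Fq) :
    polyIn t (g - g') = polyIn t g - polyIn t g' := by
  simp [polyIn, sub_mul, Finset.sum_sub_distrib]

lemma polyIn_ne_zero {Fq A : Type*} [Field Fq] [CommRing A] [Algebra Fq A] {t : A}
    (ht : Transcendental Fq t) {m : ℕ} {g : Fin m → Fq} (hg : g ≠ 0) :
    polyIn t g ≠ 0 := by
  intro h
  obtain ⟨j, hj⟩ := Function.ne_iff.1 hg
  refine ht ⟨∑ j : Fin m, Polynomial.monomial (j : ℕ) (g j), fun h0 => hj ?_, ?_⟩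
  · have := congrArg (fun p => Polynomial.coeff p (j : ℕ)) h0
    simpa [Polynomial.finsetSum_coeff, Polynomial.coeff_monomial, Fin.val_inj] using this
  · rw [map_sum, ← h, polyIn]
    exact Finset.sum_congr rfl fun j _ => by rw [Polynomial.aeval_monomial]

lemma tauDegree_polyIn_le {t : A} (ht : 0 < (φ.toRingHom t).tauDegree) {m : ℕ} (g : Fin m → Fq) :
    (φ.toRingHom (polyIn t g)).tauDegree ≤ (φ.toRingHom t).tauDegree * m := by
  refine TwistedPoly.tauDegree_le fun n hn => ?_
  have h : ∀ s : Finset (Fin m),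
      (φ.toRingHom (∑ j ∈ s, algebraMap Fq A (g j) * t ^ (j : ℕ))).coeff n = 0 := by
    classical
    intro s
    induction s using Finset.induction_on with
    | empty => simp
    | insert j s hj ih =>
      rw [Finset.sum_insert hj, map_add, TwistedPoly.coeff_add, ih, add_zero, map_mul]
      refine TwistedPoly.coeff_eq_zero_of_lt ((TwistedPoly.tauDegree_mul_le _ _).trans_lt ?_)
      rw [tauDegree_algebraMap, φ.tauDegree_pow ht, zero_add]
      refine lt_of_le_of_lt ?_ hn
      rw [mul_comm]
      exact Nat.mul_le_mul_left _ j.2.le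
  exact h _

lemma toRingHom_ne_zero (hi : Function.Injective i) {b : A} (hb : b ≠ 0) : φ.toRingHom b ≠ 0 := by
  intro h
  have := φ.coeff_zero b
  rw [h, TwistedPoly.coeff_zero'] at this
  exact hb (hi (by rw [← this, map_zero]))

open TwistedPoly

variable {v : Valuation L ℤᵐ⁰} {e : ℕ} {α : ℕ → ℤ} {N r₀ : ℕ} {R : ℤ}

/-- A point of the stable disc has its whole orbit there, so its orders are bounded below and its
local limit is 0. -/
lemma ne_zero_and_depth_pos {t : A} (ht : 0 < (φ.toRingHom t).tauDegree)
    (S : TameSetup (φ.toRingHom t) v e α N r₀ R) {y : L} (hy : φ.localLimit t v y < 0) :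
    y ≠ 0 ∧ 0 < depth (φ.toRingHom t) v e R y := by
  by_contra hcon
  have h0 : y = 0 ∨ depth (φ.toRingHom t) v e R y ≤ 0 := by
    by_contra! h
    exact hcon h
  have key : ∀ n, (φ.toRingHom t).eval^[n] y = 0 ∨
      depth (φ.toRingHom t) v e R ((φ.toRingHom t).eval^[n] y) ≤ 0 := by
    intro n
    induction n with
    | zero => exact h0
    | succ n ih =>
      rw [Function.iterate_succ_apply']
      by_cases h1 : (φ.toRingHom t).eval ((φ.toRingHom t).eval^[n] y) = 0
      · exact Or.inl h1
      · have h2 : (φ.toRingHom t).eval^[n] y ≠ 0 := fun h => h1 (by rw [h, eval_map_zero])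
        exact Or.inr (S.depth_eval_nonpos h2 (ih.resolve_left h2) h1)
  refine hy.ne (φ.localLimit_eq_zero_of_bounded v ht (m := -|(e : ℤ) * R|) fun n => ?_)
  rw [eval_pow_eq_iterate]
  rcases key n with h | h
  · rw [h, ordAt_zero]
    exact neg_nonpos.2 (abs_nonneg _)
  · have hD := slopeDenom_card_pos (φ.toRingHom t)
    unfold depth at h
    have h1 := neg_abs_le ((e : ℤ) * R)
    have h2 := abs_nonneg ((e : ℤ) * R)
    by_contra! h3
    nlinarith

lemma neg_localLimit_ge_of_depth {t : A} (ht : 0 < (φ.toRingHom t).tauDegree)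
    (S : TameSetup (φ.toRingHom t) v e α N r₀ R) {y : L}
    (hy : 3 * N * slopeDenom (Fintype.card Fq) (φ.toRingHom t).tauDegree * e <
      depth (φ.toRingHom t) v e R y) :
    (N * e : ℝ) ≤ -φ.localLimit t v y := by
  have := φ.localLimit_le_of_lt v ht S.coeffBound (S.ordAt_lt_of_depth hy)
  push_cast at this
  linarith

lemma localLimit_iterate {t : A} (ht : 0 < (φ.toRingHom t).tauDegree) (y : L) (n : ℕ) :
    φ.localLimit t v ((φ.toRingHom t).eval^[n] y) =
      (Fintype.card Fq : ℝ) ^ ((φ.toRingHom t).tauDegree * n) * φ.localLimit t v y := by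
  have h0 : φ.toRingHom (t ^ n) ≠ 0 := by
    rw [map_pow]
    exact pow_ne_zero' (ne_zero_of_tauDegree_pos ht) n
  rw [← eval_pow_eq_iterate, φ.localLimit_eval v ht h0, φ.tauDegree_pow ht, mul_comm n]

/-- A point with all iterates free of cancellation escapes after about `log e / (r₀ log q)`
steps. -/
lemma neg_localLimit_ge_of_not_dvd {t : A} (ht : 0 < (φ.toRingHom t).tauDegree) (hN : 1 ≤ N)
    (hr₀ : 1 ≤ r₀)
    (S : TameSetup (φ.toRingHom t) v e α N r₀ R) {y : L} (hy : φ.localLimit t v y < 0)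
    (hdvd : ¬ (e : ℤ) ∣ slopeDenom (Fintype.card Fq) (φ.toRingHom t).tauDegree * ordAt v y) :
    (N * e : ℝ) ≤ ((3 * N * slopeDenom (Fintype.card Fq) (φ.toRingHom t).tauDegree *
      Fintype.card Fq ^ r₀ : ℕ) * (e : ℝ)) ^ (((φ.toRingHom t).tauDegree : ℝ) / r₀) *
        (-φ.localLimit t v y) := by
  set D := slopeDenom (Fintype.card Fq) (φ.toRingHom t).tauDegree with hDdef
  have hq : 2 ≤ Fintype.card Fq := Fintype.one_lt_card
  set q := Fintype.card Fq
  have hD : 0 < D := slopeDenom_pos hq _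
  have he := S.e_pos
  obtain ⟨n, hn1, hn2⟩ : ∃ n : ℕ, 3 * N * D * e < q ^ (r₀ * n) ∧
      q ^ (r₀ * n) ≤ 3 * N * D * q ^ r₀ * e := by
    have hq0 : 1 < q ^ r₀ := Nat.one_lt_pow (by omega) hq
    have hpos : 3 * N * D * e ≠ 0 := by positivity
    -- The least number of steps after which a depth of at least 1 certainly exceeds `3NDe`; the
    -- overshoot is at most one factor `q ^ r₀`.
    refine ⟨Nat.log (q ^ r₀) (3 * N * D * e) + 1, ?_, ?_⟩
    · rw [pow_mul]
      exact Nat.lt_pow_succ_log_self hq0 _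
    · rw [pow_mul, pow_succ]
      calc _ ≤ (3 * N * D * e) * q ^ r₀ := Nat.mul_le_mul_right _ (Nat.pow_log_le_self _ hpos)
        _ = _ := by ring
  have hdep := (φ.ne_zero_and_depth_pos ht S hy).2
  have h1 := S.depth_iterate (n := n) (fun k _ => (S.noCancel_iterate hdvd k).1) hdep
  have h2 : (3 * N * D * e : ℤ) < depth (φ.toRingHom t) v e R ((φ.toRingHom t).eval^[n] y) := by
    have h3 : (3 * N * D * e : ℤ) < (q : ℤ) ^ (r₀ * n) := by exact_mod_cast hn1
    have h4 : (0 : ℤ) < (q : ℤ) ^ (r₀ * n) := by positivity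
    nlinarith
  have h3 := φ.neg_localLimit_ge_of_depth ht S h2
  rw [φ.localLimit_iterate ht, ← mul_neg] at h3
  refine h3.trans (mul_le_mul_of_nonneg_right ?_ (by linarith))
  have hr₀' : (0 : ℝ) < r₀ := by exact_mod_cast hr₀
  -- The source of the exponent: depth grows at rate `q ^ r₀` per step but the local limit at rate
  -- `q ^ r`.
  have h5 : ((q : ℝ) ^ ((φ.toRingHom t).tauDegree * n)) =
      ((q : ℝ) ^ (r₀ * n)) ^ (((φ.toRingHom t).tauDegree : ℝ) / r₀) := by
    rw [← Real.rpow_natCast, ← Real.rpow_natCast, ← Real.rpow_mul (Nat.cast_nonneg _)]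
    congr 1
    push_cast
    field_simp
  rw [h5]
  refine Real.rpow_le_rpow (by positivity) ?_ (by positivity)
  exact_mod_cast hn2

/-- Either a combination of few iterates has order not divisible by `e / D`, or a combination of
few iterates is far away from the filled Julia set. -/
lemma exists_polyIn_escape {t : A} (hi : Function.Injective i) (htr : Transcendental Fq t)
    (ht : 0 < (φ.toRingHom t).tauDegree) (hr₀ : 1 ≤ r₀)
    (S : TameSetup (φ.toRingHom t) v e α N r₀ R) {x : L} (hx : φ.localLimit t v x < 0)
    {D n₀ m : ℕ} (hD : D = slopeDenom (Fintype.card Fq) (φ.toRingHom t).tauDegree)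
    (hn₀ : n₀ = 3 * N * D) (hm : m = (φ.toRingHom t).tauDegree * n₀ * (3 * N * D) + 1) :
    ∃ g : Fin m → Fq, g ≠ 0 ∧
      (¬ (e : ℤ) ∣ D * ordAt v ((φ.toRingHom (polyIn t g)).eval x) ∨
        (N * e : ℝ) ≤ (Fintype.card Fq : ℝ) ^ ((φ.toRingHom t).tauDegree * n₀) *
          (-φ.localLimit t v ((φ.toRingHom (polyIn t g)).eval x))) := by
  classical
  by_contra! hcon
  have hq : 2 ≤ Fintype.card Fq := Fintype.one_lt_card
  have hneg : ∀ g : Fin m → Fq, g ≠ 0 →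
      φ.localLimit t v ((φ.toRingHom (polyIn t g)).eval x) < 0 := by
    intro g hg
    rw [φ.localLimit_eval v ht (φ.toRingHom_ne_zero hi (polyIn_ne_zero htr hg))]
    exact mul_neg_of_pos_of_neg (by positivity) hx
  have hsub : ∀ g g' : Fin m → Fq, (φ.toRingHom (polyIn t g)).eval x -
      (φ.toRingHom (polyIn t g')).eval x = (φ.toRingHom (polyIn t (g - g'))).eval x := by
    intro g g'
    rw [polyIn_sub, map_sub, eval_sub]
  let f : (Fin m → Fq) → L := fun g => (φ.toRingHom (polyIn t g)).eval x
  -- No nonzero combination kills `x`, because its local limit would then be 0.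
  have hf : Function.Injective f := by
    intro g g' h
    by_contra hne
    have h1 := (φ.ne_zero_and_depth_pos ht S (hneg (g - g') (sub_ne_zero.2 hne))).1
    rw [← hsub] at h1
    exact h1 (sub_eq_zero.2 h)
  -- A point of order below `-2Ne` would already have `-V ≥ Ne`, against `hcon`.
  have hord : ∀ g : Fin m → Fq, g ≠ 0 → ordAt v (f g) ∈ annulusOrders e N D := by
    intro g hg
    rw [hD]
    refine S.ordAt_mem_annulusOrders (φ.ne_zero_and_depth_pos ht S (hneg g hg)).2
      (fun hlt => ?_) (hD ▸ (hcon g hg).1)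
    have h1 := φ.localLimit_le_of_lt v ht S.coeffBound hlt
    push_cast at h1
    have h2 : (1 : ℝ) ≤ (Fintype.card Fq : ℝ) ^ ((φ.toRingHom t).tauDegree * n₀) :=
      one_le_pow₀ (by exact_mod_cast (by omega : 1 ≤ Fintype.card Fq))
    have h3 := (hcon g hg).2
    have h4 : (0 : ℝ) ≤ N * e := by positivity
    nlinarith [hneg g hg]
  set Q := (Fintype.card Fq ^ (φ.toRingHom t).tauDegree) ^ n₀ with hQ
  have hQpos : 0 < Q := by positivity
  obtain ⟨β, T, hT, hcard, hsep⟩ := exists_equidistant_subset v (Q := Q) (annulusOrders e N D)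
    (Finset.univ.image f) (by
      intro a ha b hb hab
      obtain ⟨g, -, rfl⟩ := Finset.mem_image.1 ha
      obtain ⟨g', -, rfl⟩ := Finset.mem_image.1 hb
      have hne : g ≠ g' := fun h => hab (by rw [h])
      simp only [f, hsub]
      exact hord _ (sub_ne_zero.2 hne)) (by
      rw [Finset.card_image_of_injective _ hf, Finset.card_univ, Fintype.card_fun, Fintype.card_fin]
      calc Q ^ (annulusOrders e N D).card ≤ Q ^ (3 * N * D) :=
            Nat.pow_le_pow_right hQpos (card_annulusOrders_le e N D)
        _ = Fintype.card Fq ^ ((φ.toRingHom t).tauDegree * n₀ * (3 * N * D)) := by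
            rw [hQ, ← pow_mul, ← pow_mul]
            congr 1
            ring
        -- The value of `m` is chosen so that the `q ^ m` combinations outnumber `Q ^ (3ND)`.
        _ < Fintype.card Fq ^ m := Nat.pow_lt_pow_right hq (by omega)) hQpos
  obtain ⟨a, ha, b, hb, hab, hnc⟩ := exists_sub_noCancel v (ne_zero_of_tauDegree_pos ht) n₀ T β
    hsep hcard
  obtain ⟨g, -, rfl⟩ := Finset.mem_image.1 (hT ha)
  obtain ⟨g', -, rfl⟩ := Finset.mem_image.1 (hT hb)
  have hne : g - g' ≠ 0 := sub_ne_zero.2 fun h => hab (by rw [h])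
  simp only [f, hsub] at hnc
  have hdep := (φ.ne_zero_and_depth_pos ht S (hneg _ hne)).2
  have h1 := S.depth_iterate hnc hdep
  have h2 := le_depth_of_dvd hdep (hD ▸ (hcon _ hne).1)
  -- Since the depth is at least `e`, it only has to grow by a factor above `3ND`, which `n₀ = 3ND`
  -- steps achieve whatever `e` is.
  have h3 : (3 * N * D : ℤ) < (Fintype.card Fq : ℤ) ^ (r₀ * n₀) := by
    have h4 : n₀ < Fintype.card Fq ^ (r₀ * n₀) :=
      calc n₀ < 2 ^ n₀ := Nat.lt_two_pow_self
        _ ≤ 2 ^ (r₀ * n₀) := Nat.pow_le_pow_right (by norm_num) (Nat.le_mul_of_pos_left _ hr₀)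
        _ ≤ _ := Nat.pow_le_pow_left hq _
    rw [hn₀] at h4 ⊢
    exact_mod_cast h4
  have he : (0 : ℤ) < e := by exact_mod_cast S.e_pos
  have h5 := φ.neg_localLimit_ge_of_depth ht S (y := (φ.toRingHom t).eval^[n₀]
    ((φ.toRingHom (polyIn t (g - g'))).eval x)) (by
      rw [← hD]
      have h6 : (0 : ℤ) < (Fintype.card Fq : ℤ) ^ (r₀ * n₀) := by positivity
      nlinarith)
  rw [φ.localLimit_iterate ht, ← mul_neg] at h5
  exact absurd h5 (not_le.2 (hcon _ hne).2)

/-- The constant in the lower bound at the places where the orders of the coefficients of `φ_t` are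
bounded by `N`. -/
def lehmerConstant (q r r₀ N : ℕ) : ℝ :=
  let D := slopeDenom q r
  ((q : ℝ) ^ (r * (r * (3 * N * D) * (3 * N * D) + 1)) * (q : ℝ) ^ (r * (3 * N * D)) *
    ((3 * N * D * q ^ r₀ : ℕ) : ℝ) ^ ((r : ℝ) / r₀))⁻¹

lemma lehmerConstant_pos {q r r₀ N : ℕ} (hq : 2 ≤ q) (hN : 1 ≤ N) :
    0 < lehmerConstant q r r₀ N := by
  have := slopeDenom_pos hq r
  unfold lehmerConstant
  positivity

/-- The lower bound for the local limit at a tamely ramified place. -/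
theorem le_neg_localLimit {t : A} (hi : Function.Injective i) (htr : Transcendental Fq t)
    (ht : 0 < (φ.toRingHom t).tauDegree) (hr₀ : 1 ≤ r₀) (hr : r₀ ≤ (φ.toRingHom t).tauDegree)
    (hN : 1 ≤ N) (S : TameSetup (φ.toRingHom t) v e α N r₀ R) {x : L}
    (hx : φ.localLimit t v x < 0) :
    lehmerConstant (Fintype.card Fq) (φ.toRingHom t).tauDegree r₀ N /
      (e : ℝ) ^ (((φ.toRingHom t).tauDegree : ℝ) / r₀ - 1) ≤ -φ.localLimit t v x := by
  have hq : 2 ≤ Fintype.card Fq := Fintype.one_lt_card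
  set r := (φ.toRingHom t).tauDegree with hrdef
  set q := Fintype.card Fq with hqdef
  obtain ⟨D, hDdef⟩ : ∃ D, D = slopeDenom q r := ⟨_, rfl⟩
  obtain ⟨n₀, hn₀⟩ : ∃ n₀, n₀ = 3 * N * D := ⟨_, rfl⟩
  obtain ⟨m, hm⟩ : ∃ m, m = r * n₀ * (3 * N * D) + 1 := ⟨_, rfl⟩
  obtain ⟨g, hg, hor⟩ := φ.exists_polyIn_escape hi htr ht hr₀ S hx hDdef hn₀ hm
  have hD : 0 < D := hDdef ▸ slopeDenom_pos hq _
  have he1 : (1 : ℝ) ≤ e := by exact_mod_cast S.e_pos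
  have hq1 : (1 : ℝ) ≤ q := by exact_mod_cast (by omega : 1 ≤ q)
  have hN1 : (1 : ℝ) ≤ N := by exact_mod_cast hN
  have hr1 : 1 ≤ (r : ℝ) / r₀ := by
    rw [one_le_div₀ (by exact_mod_cast hr₀)]
    exact_mod_cast hr
  have hlim := φ.localLimit_eval v ht (φ.toRingHom_ne_zero hi (polyIn_ne_zero htr hg)) x
  set V := -φ.localLimit t v x with hV
  have hVpos : 0 < V := by linarith
  have hneg : φ.localLimit t v ((φ.toRingHom (polyIn t g)).eval x) < 0 := by
    rw [hlim]
    exact mul_neg_of_pos_of_neg (by positivity) hx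
  have hb : -φ.localLimit t v ((φ.toRingHom (polyIn t g)).eval x) ≤ (q : ℝ) ^ (r * m) * V := by
    rw [hlim, ← mul_neg]
    exact mul_le_mul_of_nonneg_right
      (pow_le_pow_right₀ hq1 (φ.tauDegree_polyIn_le ht g)) hVpos.le
  set B : ℝ := ((n₀ * q ^ r₀ : ℕ) : ℝ) with hB
  have hB1 : 1 ≤ B := by
    have hn₀' : 0 < n₀ := by rw [hn₀]; positivity
    have : 1 ≤ n₀ * q ^ r₀ := Nat.one_le_iff_ne_zero.2 (by positivity)
    rw [hB]
    exact_mod_cast this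
  have hBr : 1 ≤ B ^ ((r : ℝ) / r₀) := Real.one_le_rpow hB1 (by positivity)
  have her : (1 : ℝ) ≤ (e : ℝ) ^ ((r : ℝ) / r₀) := Real.one_le_rpow he1 (by positivity)
  have hqn : (1 : ℝ) ≤ (q : ℝ) ^ (r * n₀) := one_le_pow₀ hq1
  have hmain : (e : ℝ) ≤ (q : ℝ) ^ (r * m) * (q : ℝ) ^ (r * n₀) * B ^ ((r : ℝ) / r₀) *
      (e : ℝ) ^ ((r : ℝ) / r₀) * V := by
    have hNe : (e : ℝ) ≤ N * e := le_mul_of_one_le_left (by linarith) hN1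
    rcases hor with h | h
    · have h1 := φ.neg_localLimit_ge_of_not_dvd ht hN hr₀ S hneg (hDdef ▸ h)
      rw [← hqdef, ← hrdef, ← hDdef, ← hn₀, Real.mul_rpow (by positivity) (by linarith)] at h1
      refine hNe.trans (h1.trans ?_)
      calc _ ≤ B ^ ((r : ℝ) / r₀) * (e : ℝ) ^ ((r : ℝ) / r₀) * ((q : ℝ) ^ (r * m) * V) := by
            exact mul_le_mul_of_nonneg_left hb (by positivity)
        _ = 1 * (B ^ ((r : ℝ) / r₀) * (e : ℝ) ^ ((r : ℝ) / r₀) * ((q : ℝ) ^ (r * m) * V)) := by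
            rw [one_mul]
        _ ≤ (q : ℝ) ^ (r * n₀) *
            (B ^ ((r : ℝ) / r₀) * (e : ℝ) ^ ((r : ℝ) / r₀) * ((q : ℝ) ^ (r * m) * V)) :=
            mul_le_mul_of_nonneg_right hqn (by positivity)
        _ = _ := by ring
    · refine hNe.trans (h.trans ?_)
      calc _ ≤ (q : ℝ) ^ (r * n₀) * ((q : ℝ) ^ (r * m) * V) :=
            mul_le_mul_of_nonneg_left hb (by positivity)
        _ = 1 * ((q : ℝ) ^ (r * n₀) * ((q : ℝ) ^ (r * m) * V)) := by rw [one_mul]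
        _ ≤ (B ^ ((r : ℝ) / r₀) * (e : ℝ) ^ ((r : ℝ) / r₀)) *
            ((q : ℝ) ^ (r * n₀) * ((q : ℝ) ^ (r * m) * V)) :=
            mul_le_mul_of_nonneg_right (one_le_mul_of_one_le_of_one_le hBr her) (by positivity)
        _ = _ := by ring
  have hconst : lehmerConstant q r r₀ N =
      ((q : ℝ) ^ (r * m) * (q : ℝ) ^ (r * n₀) * B ^ ((r : ℝ) / r₀))⁻¹ := by
    rw [lehmerConstant, hB, hm, hn₀, hDdef]
  -- Dividing `e ^ (r / r₀)` by the `e` on the left of `hmain` gives the `-1` in the exponent.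
  rw [hconst, Real.rpow_sub_one (by linarith), inv_eq_one_div, div_div, div_le_iff₀ (by positivity)]
  rw [← mul_div_assoc, ← mul_div_assoc, le_div_iff₀ (by linarith), one_mul]
  linarith

end DrinfeldModule

lemma ramificationIndex_spec {K L : Type*} [Field K] [Field L] [Algebra K L]
    {v : Valuation K ℤᵐ⁰} {w : Valuation L ℤᵐ⁰} (h : ramificationIndex v w ≠ 0) :
    0 < ramificationIndex v w ∧
      ∀ y : K, ordAt w (algebraMap K L y) = ramificationIndex v w * ordAt v y :=
  Nat.sInf_mem (Nat.nonempty_of_pos_sInf (Nat.pos_of_ne_zero h))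

namespace DrinfeldModule

variable {Fq A K : Type*} [Field Fq] [Fintype Fq] [CommRing A] [Algebra Fq A]
  [Field K] [Algebra Fq K] {i : A →ₐ[Fq] K} (φ : DrinfeldModule i)
  {L : Type*} [Field L] [Algebra K L]

lemma localLimit_nonpos (v : Valuation L ℤᵐ⁰) {a : A} (ha : 0 < (φ.toRingHom a).tauDegree)
    (y : L) : φ.localLimit a v y ≤ 0 :=
  le_of_tendsto' (φ.tendsto_localSeq v ha y) fun n =>
    div_nonpos_of_nonpos_of_nonneg (by exact_mod_cast ordMinus_nonpos v _) (by positivity)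

end DrinfeldModule

end

theorem theoremT
    -- the curve over `Fq` with function field `F`, the closed point `inf`, `A = regularAway Fq inf`
    {Fq F : Type*} [Field Fq] [Fintype Fq] (p : ℕ) [CharP Fq p] [Field F] [Algebra Fq F]
    (hFG : (⊤ : IntermediateField Fq F).FG) (htrdeg : Algebra.trdeg Fq F = 1)
    (inf : ValuationSubring F) (hinf : IsPlace Fq inf)
    -- the field `K` and its projective model `V` over a finite field `k`
    {k K : Type*} [Field k] [Finite k] [Field K] [Algebra Fq k] [Algebra k K] [Algebra Fq K]
    [IsScalarTower Fq k K] (V : NormalProjectiveModel k K)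
    -- the Drinfeld module of generic characteristic
    (i : regularAway Fq inf →ₐ[Fq] K) (hi : Function.Injective i) (φ : DrinfeldModule i) :
    ∃ C : ℝ, 0 < C ∧
      ∀ t : regularAway Fq inf, Transcendental Fq t →
      ∀ r₀ r : ℕ, IsLeast {n : ℕ | 1 ≤ n ∧ (φ.toRingHom t).coeff n ≠ 0} r₀ →
        r = (φ.toRingHom t).tauDegree →
      ∀ a : regularAway Fq inf, Transcendental Fq a →
      ∀ (x : AlgebraicClosure K) (v₀ : Valuation K ℤᵐ⁰)
        (v : Valuation (IntermediateField.adjoin K {x}) ℤᵐ⁰) [v₀.HasExtension v],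
        v₀ ∈ V.places K → v ∈ V.places (IntermediateField.adjoin K {x}) →
        ¬ p ∣ ramificationIndex v₀ v → ¬ LiesAboveInfinity i v →
        0 < φ.localHeight a V v₀ v (IntermediateField.AdjoinSimple.gen K x) →
        C / ((ramificationIndex v₀ v : ℝ) ^ ((r : ℝ) / (r₀ : ℝ) - 1) *
            (Module.finrank K (IntermediateField.adjoin K {x}) : ℝ))
          ≤ φ.localHeight a V v₀ v (IntermediateField.AdjoinSimple.gen K x) := by
  classical
  by_cases hex : ∃ n, ∃ t : regularAway Fq inf, Transcendental Fq t ∧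
      (∃ r₀, IsLeast {n : ℕ | 1 ≤ n ∧ (φ.toRingHom t).coeff n ≠ 0} r₀) ∧
      (φ.toRingHom t).tauDegree = n
  swap
  -- Without any admissible `t` the claim is vacuous.
  · exact ⟨1, one_pos, fun t ht r₀ r hr₀ _ => absurd ⟨_, t, ht, ⟨r₀, hr₀⟩, rfl⟩ hex⟩
  -- The bound is proved for an `s` of least degree and transferred to `t` at the end: `r₀` is
  -- common to both, `deg φ_s ≤ r` and `e ≥ 1`.
  obtain ⟨s, hs, ⟨s₀, hs₀⟩, hsdeg⟩ := Nat.find_spec hex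
  have hq : 2 ≤ Fintype.card Fq := Fintype.one_lt_card
  obtain ⟨N, hN, hbound⟩ := V.exists_bound_ordAt
    ((SkewPolynomial.support (φ.toRingHom s)).image (φ.toRingHom s).coeff)
  have hpos : ∀ a : regularAway Fq inf, Transcendental Fq a → 0 < (φ.toRingHom a).tauDegree :=
    fun a ha => by
      have h := (φ.isLeast_of_isLeast hi hs ha hs₀).1
      exact lt_of_lt_of_le h.1 (TwistedPoly.le_tauDegree h.2)
  refine ⟨DrinfeldModule.lehmerConstant (Fintype.card Fq) (φ.toRingHom s).tauDegree s₀ N,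
    DrinfeldModule.lehmerConstant_pos hq hN, ?_⟩
  intro t ht r₀ r hr₀ hr a ha x v₀ v _ hv₀ hv hram hinfty hheight
  obtain rfl : r₀ = s₀ := hr₀.unique (φ.isLeast_of_isLeast hi hs ht hs₀)
  have hsr : (φ.toRingHom s).tauDegree ≤ r := by
    rw [hsdeg, hr]
    exact Nat.find_min' hex ⟨t, ht, ⟨_, hr₀⟩, rfl⟩
  -- The default value 0 of the ramification index is divisible by `p`, so it is excluded by
  -- hypothesis.
  obtain ⟨he, hord⟩ := ramificationIndex_spec (v := v₀) (w := v) fun h => hram (h ▸ dvd_zero p)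
  set e := ramificationIndex v₀ v with hedef
  have hcop : IsCoprime (e : ℤ) (Fintype.card Fq : ℤ) := by
    obtain ⟨n, hp, hcard⟩ := FiniteField.card Fq p
    rw [Nat.isCoprime_iff_coprime, hcard]
    exact (((Nat.Prime.coprime_iff_not_dvd hp).2 hram).pow_left _).symm
  have habs : ∀ j, (φ.toRingHom s).coeff j ≠ 0 → |ordAt v₀ ((φ.toRingHom s).coeff j)| ≤ N :=
    fun j hj => hbound v₀ hv₀ _ (Finset.mem_image_of_mem _ (TwistedPoly.mem_support.2 hj)) hj
  obtain ⟨R, hR1, hR2, hR3⟩ := TwistedPoly.exists_radius habs hs₀.1.1 hs₀.1.2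
    fun j h1 h2 => hs₀.2 ⟨h1, h2⟩
  have S : TwistedPoly.TameSetup (φ.toRingHom s) v e
      (fun j => ordAt v₀ ((φ.toRingHom s).coeff j)) N r₀ R :=
    { e_pos := he
      coprime := hcop
      ord_coeff := fun j _ => hord _
      abs_le := habs
      nonneg := fun h0 => by
        have h1 := val_le_one_of_not_liesAboveInfinity hi hinfty s
        rw [φ.coeff_zero] at h0 ⊢
        rw [val_le_one_iff v (by simpa using h0), hord] at h1
        exact nonneg_of_mul_nonneg_right h1 (by exact_mod_cast he)
      radius_le := hR1
      radius_eq := hR2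
      abs_radius := hR3 }
  set y := IntermediateField.AdjoinSimple.gen K x
  obtain ⟨z, hz⟩ := exists_int_projectiveDegree (V.divisorIdeal v₀)
  have hlim : φ.localLimit a v y = φ.localLimit s v y :=
    φ.localLimit_eq v (hpos a ha) (hpos s hs) y
  have hnonpos := φ.localLimit_nonpos v (hpos s hs) y
  set d := Module.finrank K (IntermediateField.adjoin K {x}) with hd
  have hval : φ.localHeight a V v₀ v y =
      ((z * residueDegree v₀ v : ℤ) : ℝ) / d * -φ.localLimit s v y := by
    rw [DrinfeldModule.localHeight, hlim, NormalProjectiveModel.deg, hz]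
    push_cast
    ring
  rw [hval] at hheight ⊢
  have hlt : 0 < -φ.localLimit s v y :=
    lt_of_le_of_ne (by linarith) fun h => by simp [← h] at hheight
  have hquot := pos_of_mul_pos_left hheight hlt.le
  have hd0 : (0 : ℝ) < d := by
    rcases (Nat.cast_nonneg d : (0 : ℝ) ≤ d).eq_or_lt with h | h
    · rw [← h, div_zero] at hquot
      exact absurd hquot (lt_irrefl _)
    · exact h
  -- Positivity of the height makes the product of projective and residue degree a positive integer,
  -- hence at least 1.
  have hzf : (1 : ℝ) ≤ ((z * residueDegree v₀ v : ℤ) : ℝ) := by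
    have h1 := (div_pos_iff_of_pos_right hd0).1 hquot
    have h2 : 0 < z * residueDegree v₀ v := by exact_mod_cast h1
    exact_mod_cast h2
  have hmain := φ.le_neg_localLimit hi hs (hpos s hs) hs₀.1.1 (TwistedPoly.le_tauDegree hs₀.1.2) hN
    S (by linarith : φ.localLimit s v y < 0)
  have he1 : (1 : ℝ) ≤ e := by exact_mod_cast he
  have hC := DrinfeldModule.lehmerConstant_pos (q := Fintype.card Fq) (r := (φ.toRingHom s).tauDegree)
    (r₀ := r₀) hq hN
  have hexp : (e : ℝ) ^ (((φ.toRingHom s).tauDegree : ℝ) / r₀ - 1) ≤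
      (e : ℝ) ^ ((r : ℝ) / r₀ - 1) := by
    refine Real.rpow_le_rpow_of_exponent_le he1 (sub_le_sub_right ?_ 1)
    exact div_le_div_of_nonneg_right (by exact_mod_cast hsr) (Nat.cast_nonneg _)
  have hepos : (0 : ℝ) < (e : ℝ) ^ (((φ.toRingHom s).tauDegree : ℝ) / r₀ - 1) := by positivity
  calc _ ≤ DrinfeldModule.lehmerConstant (Fintype.card Fq) (φ.toRingHom s).tauDegree r₀ N /
        ((e : ℝ) ^ (((φ.toRingHom s).tauDegree : ℝ) / r₀ - 1) * d) := by gcongr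
    _ = 1 / d * (DrinfeldModule.lehmerConstant (Fintype.card Fq) (φ.toRingHom s).tauDegree r₀ N /
        (e : ℝ) ^ (((φ.toRingHom s).tauDegree : ℝ) / r₀ - 1)) := by
      field_simp
    _ ≤ _ := by gcongr
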